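/- Let $k,n\ge 1$ and $m\ge 0$ be integers, and let $\theta>0$ and $d\ge 1$ be real numbers. The pseudo-dimension $d$ mean field model on $n$ vertices is the complete graph $K_n$ whose edges $e$ are assigned the lengths $l_e=(nX_e)^{1/d}$, where the $X_e$ are independent exponential random variables of mean $1$. The $d$-PWIT is the random rooted infinite tree in which every vertex has a countably infinite set of children, and in which, independently for all vertices, the lengths of the edges from a vertex to its children are the points of a rate $1$ Poisson point process on $(0,\infty)$, each raised to the power $1/d$. In a graph with edge lengths, the $(k,\theta)$-neighborhood of a vertex $v$ is the subgraph which is the union of all paths from $v$ of at most $k$ edges, each of length at most $\theta$. Let $v_1,\dots,v_m$ be distinct (possibly random) vertices of $K_n$, with an arbitrary joint distribution, chosen independently of the edge lengths. Then there is a coupling of $\big((v_1,\dots,v_m),(l_e)_e\big)$ with $m$ independent $d$-PWITs such that, with probability at least $$1-\frac{(m\theta^d+m+1)^k}{n^{1/3}},$$ the union of the $(k,\theta)$-neighborhoods of $v_1,\dots,v_m$ in the mean field model is isomorphic to the disjoint union of the $(k,\theta)$-neighborhoods of the roots of the $m$ $d$-PWITs, by an isomorphism that takes $v_i$ to the root of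 the $i$-th $d$-PWIT for every $i$ and under which corresponding edges have equal length. -/

import Mathlib

open MeasureTheory ProbabilityTheory

noncomputable section

namespace MeanField

/-! ### Graphs with edge lengths -/

/-- A simple graph together with a symmetric length function. Only the values of `len` on pairs of
adjacent vertices are meaningful. -/
structure LengthGraph (V : Type) where
  graph : SimpleGraph V
  len : V → V → ℝ
  len_symm : ∀ x y, len x y = len y x

/-- The `(k, θ)`-neighborhood of a vertex `v`: the subgraph which is the union of all paths from `v`
of at most `k` edges, each of length at most `θ`. -/
def LengthGraph.nbhd {V : Type} (G : LengthGraph V) (k : ℕ) (θ : ℝ) (v : V) : G.graph.Subgraph :=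
  ⨆ (w : V) (p : G.graph.Walk v w)
    (_ : p.IsPath ∧ p.length ≤ k ∧ ∀ e ∈ p.darts, G.len e.fst e.snd ≤ θ), p.toSubgraph

/-- The disjoint union of a family of graphs with edge lengths. -/
def LengthGraph.disjointUnion {ι W : Type} [DecidableEq ι] (T : ι → LengthGraph W) :
    LengthGraph (ι × W) where
  graph :=
    { Adj := fun x y => x.1 = y.1 ∧ (T x.1).graph.Adj x.2 y.2
      symm := ⟨by
        rintro ⟨i, x⟩ ⟨j, y⟩ ⟨h, hxy⟩
        cases h
        exact ⟨rfl, hxy.symm⟩⟩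
      loopless := ⟨fun x h => (T x.1).graph.irrefl h.2⟩ }
  len := fun x y => if x.1 = y.1 then (T x.1).len x.2 y.2 else 0
  len_symm := by
    rintro ⟨i, x⟩ ⟨j, y⟩
    by_cases h : i = j
    · cases h
      simp [(T i).len_symm x y]
    · simp [h, Ne.symm h]

/-- `A` and `B`, marked by the vertices `v i` and `r i` respectively, are isomorphic as graphs by an
isomorphism that takes `v i` to `r i` for every `i` and preserves the lengths of all edges. -/
def IsoWithLengths {V W ι : Type} (G : LengthGraph V) (A : G.graph.Subgraph) (v : ι → V)
    (H : LengthGraph W) (B : H.graph.Subgraph) (r : ι → W) : Prop :=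
  ∃ φ : A.coe ≃g B.coe,
    (∀ i, ∃ h : v i ∈ A.verts, (φ ⟨v i, h⟩ : W) = r i) ∧
    ∀ x y : A.verts, A.Adj x y → H.len (φ x) (φ y) = G.len x y

/-! ### The mean field model -/

/-- The edges of the complete graph on `n` vertices. -/
abbrev Edges (n : ℕ) : Type := (⊤ : SimpleGraph (Fin n)).edgeSet

/-- The complete graph on `n` vertices with given edge lengths. -/
def completeLengthGraph {n : ℕ} (l : Edges n → ℝ) : LengthGraph (Fin n) where
  graph := ⊤
  len := fun x y => if h : x ≠ y then l ⟨s(x, y), by simpa using h⟩ else 0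
  len_symm := by
    intro x y
    by_cases h : x = y
    · simp [h]
    · simp [h, Ne.symm h, Sym2.eq_swap]

instance : IsProbabilityMeasure (expMeasure 1) := isProbabilityMeasure_expMeasure one_pos

/-- The law of the edge lengths in the pseudo-dimension `d` mean field model on `n` vertices: the
lengths are `(n * X e) ^ (1 / d)` with `X e` independent exponential variables of mean `1`. -/
def meanFieldLaw (n : ℕ) (d : ℝ) : Measure (Edges n → ℝ) :=
  (Measure.pi fun _ : Edges n => expMeasure 1).map fun X e => ((n : ℝ) * X e) ^ (1 / d)

/-! ### The Poisson weighted infinite tree -/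

/-- The law of the points, in increasing order, of a rate `1` Poisson point process on the positive
reals: the gaps between consecutive points (starting from `0`) are independent exponential variables
of mean `1`. -/
def poissonPoints : Measure (ℕ → ℝ) :=
  (Measure.infinitePi fun _ : ℕ => expMeasure 1).map fun g i => ∑ j ∈ Finset.range (i + 1), g j

instance : IsProbabilityMeasure poissonPoints :=
  Measure.isProbabilityMeasure_map (by fun_prop)

/-- The law of the `d`-PWIT. The vertices of the tree are the finite sequences of natural numbers,
the root is `[]` and the `i`-th child of `u` is `i :: u`. A realization is recorded as the function
`t`, where `t u i` is the length of the edge from `u` to its `i`-th child: independently for all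
vertices `u`, the lengths `t u 0, t u 1, …` are the points of a rate `1` Poisson point process on the
positive reals, raised to the power `1 / d`. -/
def pwitLaw (d : ℝ) : Measure (List ℕ → ℕ → ℝ) :=
  (Measure.infinitePi fun _ : List ℕ => poissonPoints).map fun t u i => (t u i) ^ (1 / d)

/-- The length of the edge from a vertex to its parent (with value `0` at the root). -/
def parentEdge (t : List ℕ → ℕ → ℝ) : List ℕ → ℝ
  | [] => 0
  | i :: u => t u i

/-- The infinite tree, with edge lengths given by `t`. -/
def treeLengthGraph (t : List ℕ → ℕ → ℝ) : LengthGraph (List ℕ) where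
  graph :=
    { Adj := fun u w => (∃ i, w = i :: u) ∨ (∃ i, u = i :: w)
      symm := ⟨fun _ _ h => h.symm⟩
      loopless := ⟨by
        rintro u (⟨i, h⟩ | ⟨i, h⟩) <;> simpa using congrArg List.length h⟩ }
  len := fun u w =>
    if u.length < w.length then parentEdge t w
    else if w.length < u.length then parentEdge t u else 0
  len_symm := by
    intro u w
    rcases lt_trichotomy u.length w.length with h | h | h
    · simp [h, h.le]
    · simp [h]
    · simp [h, h.le]

/-! ### Couplings -/

/-- `γ` is a coupling of the laws `μ` and `ν`. -/
def IsCoupling {α β : Type} [MeasurableSpace α] [MeasurableSpace β]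
    (γ : Measure (α × β)) (μ : Measure α) (ν : Measure β) : Prop :=
  γ.map Prod.fst = μ ∧ γ.map Prod.snd = ν

/-- The union of the `(k, θ)`-neighborhoods of the vertices `v i` in the complete graph with edge
lengths `l` is isomorphic to the union of the `(k, θ)`-neighborhoods of the roots in the disjoint
union of the trees with edge lengths `t i`. -/
def NbhdsIsomorphic {n m : ℕ} (k : ℕ) (θ : ℝ) (v : Fin m → Fin n) (l : Edges n → ℝ)
    (t : Fin m → List ℕ → ℕ → ℝ) : Prop :=
  let G := completeLengthGraph l
  let H := LengthGraph.disjointUnion fun i => treeLengthGraph (t i)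
  let root : Fin m → Fin m × List ℕ := fun i => (i, [])
  IsoWithLengths G (⨆ i, G.nbhd k θ (v i)) v H (⨆ i, H.nbhd k θ (root i)) root

end MeanField

end

open MeanField

namespace MeanField

/-! Fix distinct roots. A shape `V` records which vertices lie in the neighborhoods of the roots of
the trees; a labelling places it injectively in `K_n`. Let `j` be the number of edges of `V`, `N`
its number of vertices and `r` its number of vertices of depth less than `k`, and measure lengths by
their `d`-th powers. In the trees, the shape `V` with prescribed edge lengths has density at most
`exp (-θ^d * r)`, from one Poisson process on `(0, θ^d]` per inner vertex. In `K_n`, each edge of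
the labelled shape has density at least `n⁻¹ * exp (-θ^d / n)`, and each other edge at an inner
vertex is long with probability at least `exp (-θ^d / n)`. At most `n * r` edges are involved, so
the density in `K_n` is at least `n^(-j) * exp (-θ^d * r)`. Hence `n^(-j)` times the tree law on `V`
is dominated by the graph law on the labelled shape (`map_treeLengths_le`).

The graph events of different labelled shapes are disjoint (`graphEvent_disjoint`): the
neighborhoods are recovered generation by generation, siblings being ordered by length. A shape has
at most `n^j` labellings. So all these dominations can be realized simultaneously, as parts of one
coupling (`exists_coupling_of_family`), and on each part the same forest with the same lengths sits
in both graphs.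

The mass matched is the expectation of the number of labellings divided by `n^j`. As there are at
least `(n - m).descFactorial j` labellings, the loss for a given shape is at most `N / n^(1/3)`
(`one_le_descFactorial_div_add`). The expectation of `N` is at most `(m * θ^d + m + 1)^k` by the
recursion for a branching process of mean offspring at most `θ^d` (`mul_expectedSize_le`). Random
roots are handled by conditioning on their values. -/

open scoped ENNReal

/-! ### Couplings from dominated measures -/

/-- If the image of `μ` under `f` is dominated by the image of `ν` under `g`, then `μ` can be coupled
with a part of `ν` in such a way that `f` and `g` agree. -/
theorem exists_subcoupling {α β Z : Type} [MeasurableSpace α] [MeasurableSpace β]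
    [StandardBorelSpace β] [Nonempty β] [MeasurableSpace Z] [MeasurableEq Z]
    (μ : Measure α) [IsFiniteMeasure μ] (ν : Measure β) [IsFiniteMeasure ν]
    {f : α → Z} {g : β → Z} (hf : Measurable f) (hg : Measurable g) (h : μ.map f ≤ ν.map g) :
    ∃ σ : Measure (β × α), σ.map Prod.snd = μ ∧ σ.map Prod.fst ≤ ν ∧
      ∀ᵐ p ∂σ, f p.2 = g p.1 := by
  -- The conditional kernel of `ρ` is the law under `ν` of `b` given `g b`. Drawing `a` from `μ` and
  -- then `b` given `g b = f a` yields the coupling; domination of the images bounds its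
  -- `β`-marginal by `ν`.
  set ρ : Measure (Z × β) := ν.map fun b => (g b, b) with hρ
  have hgm : Measurable fun b => (g b, b) := hg.prodMk measurable_id
  have hfst : ρ.fst = ν.map g := by
    rw [Measure.fst, hρ, Measure.map_map measurable_fst hgm]; rfl
  have hsnd : ρ.snd = ν := by
    rw [Measure.snd, hρ, Measure.map_map measurable_snd hgm]
    exact Measure.map_id
  have hdis : ρ.fst ⊗ₘ ρ.condKernel = ρ := ρ.disintegrate ρ.condKernel
  set κ : Kernel Z β := ρ.condKernel
  have key : ∀ s : Set (Z × β), MeasurableSet s →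
      ∫⁻ a, κ (f a) (Prod.mk (f a) ⁻¹' s) ∂μ ≤ ρ s := by
    intro s hs
    have hm : Measurable fun z => κ z (Prod.mk z ⁻¹' s) :=
      Kernel.measurable_kernel_prodMk_left hs
    rw [← lintegral_map (f := fun z => κ z (Prod.mk z ⁻¹' s)) hm hf]
    calc _ ≤ ∫⁻ z, κ z (Prod.mk z ⁻¹' s) ∂(ν.map g) := lintegral_mono' h le_rfl
      _ = ρ s := by rw [← hfst, ← Measure.compProd_apply hs, hdis]
  refine ⟨(μ ⊗ₘ κ.comap f hf).map Prod.swap, ?_, ?_, ?_⟩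
  · rw [Measure.map_map measurable_snd measurable_swap]
    exact Measure.fst_compProd μ _
  · rw [Measure.map_map measurable_fst measurable_swap]
    refine Measure.le_iff.2 fun s hs => ?_
    rw [Measure.map_apply (by fun_prop) hs,
      Measure.compProd_apply ((measurable_fst.comp measurable_swap) hs)]
    have := key (Prod.snd ⁻¹' s) (measurable_snd hs)
    have h2 : ρ (Prod.snd ⁻¹' s) = ν s := by
      rw [← Measure.map_apply measurable_snd hs]
      exact congrArg (fun m => m s) hsnd
    rw [h2] at this
    exact this
  · have hms : MeasurableSet {p : Z × β | p.1 ≠ g p.2} :=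
      (measurableSet_eq_fun measurable_fst (hg.comp measurable_snd)).compl
    have h0 : ρ {p : Z × β | p.1 ≠ g p.2} = 0 := by
      rw [hρ, Measure.map_apply hgm hms]
      simp
    have h1 := key _ hms
    rw [h0] at h1
    refine (ae_map_iff measurable_swap.aemeasurable
      (measurableSet_eq_fun (hf.comp measurable_snd) (hg.comp measurable_fst))).2 ?_
    have hms' : MeasurableSet {p : α × β | f p.1 ≠ g p.2} :=
      (measurableSet_eq_fun (hf.comp measurable_fst) (hg.comp measurable_snd)).compl
    have : (μ ⊗ₘ κ.comap f hf) {p : α × β | f p.1 ≠ g p.2} = 0 := by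
      rw [Measure.compProd_apply hms']
      exact le_antisymm h1 zero_le
    exact this

/-- A measure whose marginals are dominated by two probability measures is a part of a coupling. -/
theorem exists_coupling_of_le {α β : Type} [MeasurableSpace α] [MeasurableSpace β]
    (ν : Measure β) [IsProbabilityMeasure ν] (μ : Measure α) [IsProbabilityMeasure μ]
    (σ : Measure (β × α)) (h₁ : σ.map Prod.fst ≤ ν) (h₂ : σ.map Prod.snd ≤ μ) :
    ∃ γ : Measure (β × α), IsCoupling γ ν μ ∧ σ ≤ γ := by
  have hu₁ : σ.map Prod.fst Set.univ = σ Set.univ := by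
    rw [Measure.map_apply measurable_fst .univ]; rfl
  have hu₂ : σ.map Prod.snd Set.univ = σ Set.univ := by
    rw [Measure.map_apply measurable_snd .univ]; rfl
  have hσ1 : σ Set.univ ≤ 1 := by
    rw [← hu₁]; simpa using h₁ Set.univ
  have : IsFiniteMeasure σ := ⟨hσ1.trans_lt ENNReal.one_lt_top⟩
  have : IsFiniteMeasure (σ.map Prod.fst) := Measure.isFiniteMeasure_map _ _
  have : IsFiniteMeasure (σ.map Prod.snd) := Measure.isFiniteMeasure_map _ _
  have e₁ := Measure.sub_add_cancel_of_le h₁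
  have e₂ := Measure.sub_add_cancel_of_le h₂
  set ν' := ν - σ.map Prod.fst
  set μ' := μ - σ.map Prod.snd
  have m₁ : ν' Set.univ + σ Set.univ = 1 := by
    have := congrArg (fun m => m Set.univ) e₁
    simpa [hu₁] using this
  have m₂ : μ' Set.univ + σ Set.univ = 1 := by
    have := congrArg (fun m => m Set.univ) e₂
    simpa [hu₂] using this
  have hm : ν' Set.univ = μ' Set.univ := by
    have := m₁.trans m₂.symm
    exact (ENNReal.add_left_inj (measure_ne_top σ _)).1 this
  have : IsFiniteMeasure ν' := ⟨(le_of_le_of_eq le_self_add m₁).trans_lt ENNReal.one_lt_top⟩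
  have : IsFiniteMeasure μ' := ⟨(le_of_le_of_eq le_self_add m₂).trans_lt ENNReal.one_lt_top⟩
  by_cases h0 : ν' Set.univ = 0
  · have z₁ : ν' = 0 := Measure.measure_univ_eq_zero.1 h0
    have z₂ : μ' = 0 := Measure.measure_univ_eq_zero.1 (hm ▸ h0)
    refine ⟨σ, ⟨?_, ?_⟩, le_rfl⟩
    · rw [← e₁, z₁, zero_add]
    · rw [← e₂, z₂, zero_add]
  -- The uncovered remainders `ν'` and `μ'` have equal mass; they are coupled independently,
  -- normalized by that mass.
  · refine ⟨σ + (ν' Set.univ)⁻¹ • ν'.prod μ', ⟨?_, ?_⟩, Measure.le_add_right le_rfl⟩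
    · rw [Measure.map_add _ _ measurable_fst, Measure.map_smul, Measure.map_fst_prod, ← hm,
        smul_smul, ENNReal.inv_mul_cancel h0 (measure_ne_top _ _), one_smul, add_comm, e₁]
    · rw [Measure.map_add _ _ measurable_snd, Measure.map_smul, Measure.map_snd_prod,
        smul_smul, ENNReal.inv_mul_cancel h0 (measure_ne_top _ _), one_smul, add_comm, e₂]

/-- A coupling of `ν` and `μ` glued from couplings of parts of `μ` with disjoint parts of `ν`. -/
theorem exists_coupling_of_family {α β ι : Type} [Countable ι] {Z : ι → Type}
    [MeasurableSpace α] [MeasurableSpace β] [StandardBorelSpace β] [Nonempty β]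
    [∀ i, MeasurableSpace (Z i)] [∀ i, MeasurableEq (Z i)]
    (ν : Measure β) [IsProbabilityMeasure ν] (μ : Measure α) [IsProbabilityMeasure μ]
    {A : ι → Set α} {B : ι → Set β} (hA : ∀ i, MeasurableSet (A i)) (hB : ∀ i, MeasurableSet (B i))
    (hd : Pairwise (Function.onFun Disjoint B)) {c : ι → ℝ≥0∞} (hc : ∀ i, c i ≠ ∞)
    {f : ∀ i, α → Z i} {g : ∀ i, β → Z i} (hf : ∀ i, Measurable (f i)) (hg : ∀ i, Measurable (g i))
    (hle : ∀ i, (c i • μ.restrict (A i)).map (f i) ≤ (ν.restrict (B i)).map (g i))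
    (hμ : Measure.sum (fun i => c i • μ.restrict (A i)) ≤ μ) :
    ∃ γ : Measure (β × α), IsCoupling γ ν μ ∧
      ∑' i, c i * μ (A i) ≤ γ {p | ∃ i, p.2 ∈ A i ∧ p.1 ∈ B i ∧ f i p.2 = g i p.1} := by
  have hfin : ∀ i, IsFiniteMeasure (c i • μ.restrict (A i)) := fun i =>
    Measure.smul_finite _ (hc i)
  choose σ h₁ h₂ h₃ using fun i => exists_subcoupling _ _ (hf i) (hg i) (hle i)
  -- Disjointness of the sets `B i` is what lets the parts of `ν` be used together.
  have m₁ : (Measure.sum σ).map Prod.fst ≤ ν := by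
    rw [Measure.map_sum measurable_fst.aemeasurable]
    calc _ ≤ Measure.sum fun i => ν.restrict (B i) := by
          refine Measure.le_iff.2 fun s hs => ?_
          rw [Measure.sum_apply _ hs, Measure.sum_apply _ hs]
          exact ENNReal.tsum_le_tsum fun i => h₂ i s
      _ = ν.restrict (⋃ i, B i) := (Measure.restrict_iUnion hd hB).symm
      _ ≤ ν := Measure.restrict_le_self
  have m₂ : (Measure.sum σ).map Prod.snd ≤ μ := by
    rw [Measure.map_sum measurable_snd.aemeasurable]
    simpa only [h₁] using hμ
  obtain ⟨γ, hγ, hle'⟩ := exists_coupling_of_le ν μ _ m₁ m₂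
  refine ⟨γ, hγ, le_trans ?_ (hle' _)⟩
  refine le_trans (ENNReal.tsum_le_tsum fun i => ?_) (Measure.le_sum_apply _ _)
  have ea : ∀ᵐ p ∂σ i, p.2 ∈ A i := by
    have : ∀ᵐ a ∂(σ i).map Prod.snd, a ∈ A i := by
      rw [h₁]
      exact Measure.ae_smul_measure (ae_restrict_mem (hA i)) _
    exact ae_of_ae_map measurable_snd.aemeasurable this
  have eb : ∀ᵐ p ∂σ i, p.1 ∈ B i := by
    have : ∀ᵐ a ∂(σ i).map Prod.fst, a ∈ B i :=
      (Measure.absolutelyContinuous_of_le (h₂ i)).ae_le (ae_restrict_mem (hB i))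
    exact ae_of_ae_map measurable_fst.aemeasurable this
  have hu : σ i Set.univ = c i * μ (A i) := by
    have := congrArg (fun m => m Set.univ) (h₁ i)
    simpa [Measure.map_apply measurable_snd MeasurableSet.univ] using this
  rw [← hu]
  refine measure_mono_ae ?_
  filter_upwards [ea, eb, h₃ i] with p h1 h2 h3 _
  exact ⟨i, h1, h2, h3⟩

/-- Couplings given the values of a further random variable that takes countably many values. -/
theorem exists_coupling_of_conditional {δ α β : Type} [Countable δ] [MeasurableSpace δ]
    [MeasurableSingletonClass δ] [MeasurableSpace α] [MeasurableSpace β]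
    (π : Measure δ) [IsProbabilityMeasure π] (ν : Measure β) [IsProbabilityMeasure ν]
    (μ : Measure α) [IsProbabilityMeasure μ] {S : δ → Set (β × α)}
    (hS : ∀ v, MeasurableSet (S v)) {b : ℝ≥0∞}
    (h : ∀ᵐ v ∂π, ∃ γ : Measure (β × α), IsCoupling γ ν μ ∧ b ≤ γ (S v)) :
    ∃ γ : Measure ((δ × β) × α), IsCoupling γ (π.prod ν) μ ∧
      b ≤ γ {ω | (ω.1.2, ω.2) ∈ S ω.1.1} := by
  classical
  -- Values `v` of probability zero receive the independent coupling, so that a choice exists for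
  -- every `v`.
  have hγ : ∀ v, ∃ γ : Measure (β × α), IsCoupling γ ν μ ∧ (π {v} ≠ 0 → b ≤ γ (S v)) := by
    intro v
    by_cases hv : π {v} = 0
    · refine ⟨ν.prod μ, ⟨?_, ?_⟩, fun h => absurd hv h⟩
      · simp [Measure.map_fst_prod]
      · simp [Measure.map_snd_prod]
    · obtain ⟨γ, h1, h2⟩ : ∃ γ : Measure (β × α), IsCoupling γ ν μ ∧ b ≤ γ (S v) := by
        by_contra hcon
        exact hv (measure_mono_null (fun w hw => by simpa [Set.mem_singleton_iff.1 hw] using hcon)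
          (ae_iff.1 h))
      exact ⟨γ, h1, fun _ => h2⟩
  choose γ hγ hb using hγ
  have hj : ∀ v : δ, Measurable fun p : β × α => ((v, p.1), p.2) := fun v => by fun_prop
  have hπ : Measure.sum (fun v => π {v} • Measure.dirac v) = π := Measure.sum_smul_dirac π
  refine ⟨Measure.sum fun v => π {v} • (γ v).map fun p => ((v, p.1), p.2), ⟨?_, ?_⟩, ?_⟩
  · rw [Measure.map_sum measurable_fst.aemeasurable]
    conv_rhs => rw [← hπ]
    rw [Measure.prod_sum_left]
    congr 1
    funext v
    rw [Measure.map_smul, Measure.prod_smul_left, Measure.map_map measurable_fst (hj v),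
      Measure.dirac_prod, ← (hγ v).1, Measure.map_map (by fun_prop) measurable_fst]
    rfl
  · rw [Measure.map_sum measurable_snd.aemeasurable]
    have : ∀ v, (π {v} • (γ v).map fun p => ((v, p.1), p.2)).map Prod.snd = π {v} • μ := by
      intro v
      rw [Measure.map_smul, Measure.map_map measurable_snd (hj v), ← (hγ v).2]
      rfl
    simp_rw [this]
    refine Measure.ext fun s hs => ?_
    rw [Measure.sum_apply _ hs]
    simp only [Measure.smul_apply, smul_eq_mul]
    rw [ENNReal.tsum_mul_right]
    have := congrArg (fun m => m Set.univ) hπ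
    simp only [Measure.sum_apply _ MeasurableSet.univ, Measure.smul_apply, smul_eq_mul,
      measure_univ, mul_one] at this
    rw [this, one_mul]
  · have hone : ∑' v, π {v} = 1 := by
      have := congrArg (fun m => m Set.univ) hπ
      simpa only [Measure.sum_apply _ MeasurableSet.univ, Measure.smul_apply, smul_eq_mul,
        measure_univ, mul_one] using this
    have hSm : ∀ v, MeasurableSet {ω : (δ × β) × α | ω.1.1 = v ∧ (ω.1.2, ω.2) ∈ S v} := fun v =>
      (measurableSet_eq_fun (by fun_prop) measurable_const).inter
        ((show Measurable fun ω : (δ × β) × α => (ω.1.2, ω.2) by fun_prop) (hS v))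
    refine le_trans ?_ (Measure.le_sum_apply _ _)
    calc b = ∑' v, π {v} * b := by rw [ENNReal.tsum_mul_right, hone, one_mul]
      _ ≤ _ := ENNReal.tsum_le_tsum fun v => ?_
    rw [Measure.smul_apply, smul_eq_mul]
    by_cases hv : π {v} = 0
    · simp [hv]
    gcongr
    refine (hb v hv).trans ?_
    have hsub : {ω : (δ × β) × α | ω.1.1 = v ∧ (ω.1.2, ω.2) ∈ S v} ⊆
        {ω | (ω.1.2, ω.2) ∈ S ω.1.1} := by
      rintro ω ⟨rfl, h⟩; exact h
    refine le_trans ?_ (measure_mono hsub)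
    rw [Measure.map_apply (hj v) (hSm v)]
    simp

/-! ### Neighborhoods as embedded forests -/

/-- `ψ` embeds a rooted forest, given by its roots and its parent-child relation and of depth at most
`k`, into `G` in such a way that the edges of `G` of length at most `θ` that are incident with
vertices of depth less than `k` are the edges of the forest. -/
structure ForestEmbedding {ι I V : Type} (root : ι → I) (child : I → I → Prop) (depth : I → ℕ)
    (k : ℕ) (θ : ℝ) (G : LengthGraph V) (ψ : I → V) : Prop where
  depth_root : ∀ i, depth (root i) = 0
  depth_child : ∀ p q, child p q → depth q = depth p + 1
  depth_le : ∀ p, depth p ≤ k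
  exists_parent : ∀ q, (∃ i, q = root i) ∨ ∃ p, child p q
  injective : Function.Injective ψ
  adj : ∀ p q, child p q → G.graph.Adj (ψ p) (ψ q) ∧ G.len (ψ p) (ψ q) ≤ θ
  exists_of_adj : ∀ p y, depth p < k → G.graph.Adj (ψ p) y → G.len (ψ p) y ≤ θ →
    ∃ q, (child p q ∨ child q p) ∧ ψ q = y

namespace ForestEmbedding

variable {ι I V : Type} {root : ι → I} {child : I → I → Prop} {depth : I → ℕ} {k : ℕ} {θ : ℝ}
  {G : LengthGraph V} {ψ : I → V}

/-- The walk down the forest to `q` is a path because it visits vertices of strictly increasing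
depth and `ψ` is injective. The bound on depths in the support keeps this available in the
induction. -/
theorem exists_path (h : ForestEmbedding root child depth k θ G ψ) (n : ℕ) :
    ∀ q, depth q = n → ∃ i, ∃ p : G.graph.Walk (ψ (root i)) (ψ q), p.IsPath ∧ p.length = n ∧
      (∀ e ∈ p.darts, G.len e.fst e.snd ≤ θ) ∧ ∀ x ∈ p.support, ∃ w, depth w ≤ n ∧ ψ w = x := by
  induction n with
  | zero =>
    intro q hq
    rcases h.exists_parent q with ⟨i, rfl⟩ | ⟨p, hp⟩
    · exact ⟨i, .nil, by simp, by simp, by simp, by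
        intro x hx; exact ⟨root i, hq.le, by simpa using (List.mem_singleton.1 hx).symm⟩⟩
    · have := h.depth_child p q hp; omega
  | succ n ih =>
    intro q hq
    rcases h.exists_parent q with ⟨i, rfl⟩ | ⟨p, hp⟩
    · have := h.depth_root i; omega
    · have hd := h.depth_child p q hp
      obtain ⟨i, w, hw, hl, hlen, hsup⟩ := ih p (by omega)
      refine ⟨i, w.concat (h.adj p q hp).1, ?_, by simp [hl], ?_, ?_⟩
      · refine (SimpleGraph.Walk.concat_isPath_iff _).2 ⟨hw, fun hmem => ?_⟩
        obtain ⟨w', h1, h2⟩ := hsup _ hmem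
        have := h.injective h2
        subst this
        omega
      · intro e he
        rw [SimpleGraph.Walk.darts_concat, List.concat_eq_append, List.mem_append] at he
        rcases he with he | he
        · exact hlen e he
        · rw [List.mem_singleton.1 he]; exact (h.adj p q hp).2
      · intro x hx
        rw [SimpleGraph.Walk.support_concat, List.mem_append] at hx
        rcases hx with hx | hx
        · obtain ⟨w', h1, h2⟩ := hsup x hx
          exact ⟨w', by omega, h2⟩
        · exact ⟨q, hq.le, (List.mem_singleton.1 hx).symm⟩

/-- The image of the forest. -/
def image (h : ForestEmbedding root child depth k θ G ψ) : G.graph.Subgraph where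
  verts := Set.range ψ
  Adj x y := ∃ p q, (child p q ∨ child q p) ∧ ψ p = x ∧ ψ q = y
  adj_sub := by
    rintro _ _ ⟨p, q, hpq | hpq, rfl, rfl⟩
    · exact (h.adj p q hpq).1
    · exact (h.adj q p hpq).1.symm
  edge_vert := by
    rintro _ _ ⟨p, q, -, rfl, -⟩
    exact ⟨p, rfl⟩
  symm := ⟨by
    rintro _ _ ⟨p, q, hpq, rfl, rfl⟩
    exact ⟨q, p, hpq.symm, rfl, rfl⟩⟩

/-- A short walk cannot leave the forest: a step from depth less than `k` along an edge of length at
most `θ` goes to a child or a parent, so the depth plus the number of remaining steps never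
increases. -/
theorem toSubgraph_le (h : ForestEmbedding root child depth k θ G ψ) {x y : V}
    (p : G.graph.Walk x y) : ∀ a, ψ a = x → depth a + p.length ≤ k →
      (∀ e ∈ p.darts, G.len e.fst e.snd ≤ θ) → p.toSubgraph ≤ h.image := by
  induction p with
  | nil =>
    rintro a rfl - -
    simp only [SimpleGraph.Walk.toSubgraph, SimpleGraph.singletonSubgraph_le_iff]
    exact ⟨a, rfl⟩
  | cons hadj p ih =>
    rintro a rfl hk hlen
    rw [SimpleGraph.Walk.length_cons] at hk
    obtain ⟨q, hq, rfl⟩ := h.exists_of_adj a _ (by omega) hadj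
      (hlen ⟨(_, _), hadj⟩ (by simp))
    have hdq : depth q ≤ depth a + 1 := by
      rcases hq with hq | hq
      · exact (h.depth_child _ _ hq).le
      · have := h.depth_child _ _ hq; omega
    simp only [SimpleGraph.Walk.toSubgraph, sup_le_iff]
    refine ⟨?_, ih q rfl (by omega) fun e he => hlen e (by simp [he])⟩
    exact SimpleGraph.subgraphOfAdj_le_of_adj h.image (v := ψ a) (w := ψ q) ⟨a, q, hq, rfl, rfl⟩

/-- One inclusion is `toSubgraph_le`; for the other, every forest edge is the last edge of a
descending path as in `exists_path`. -/
theorem iSup_nbhd (h : ForestEmbedding root child depth k θ G ψ) :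
    ⨆ i, G.nbhd k θ (ψ (root i)) = h.image := by
  have hle : ∀ {i y} (p : G.graph.Walk (ψ (root i)) y), p.IsPath → p.length ≤ k →
      (∀ e ∈ p.darts, G.len e.fst e.snd ≤ θ) →
      p.toSubgraph ≤ ⨆ i, G.nbhd k θ (ψ (root i)) := by
    intro i y p h1 h2 h3
    refine le_trans ?_ (le_iSup _ i)
    exact le_iSup_of_le y (le_iSup_of_le p (le_iSup_of_le ⟨h1, h2, h3⟩ le_rfl))
  apply le_antisymm
  · refine iSup_le fun i => iSup_le fun y => iSup_le fun p => iSup_le fun hp => ?_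
    exact h.toSubgraph_le p (root i) rfl (by have := hp.2.1; rw [h.depth_root]; omega) hp.2.2
  · have hadj : ∀ p q, child p q → (⨆ i, G.nbhd k θ (ψ (root i))).Adj (ψ p) (ψ q) := by
      intro p q hpq
      have hd := h.depth_child p q hpq
      obtain ⟨i, w, hw, hl, hlen, hsup⟩ := h.exists_path _ p rfl
      have hsub := hle (w.concat (h.adj p q hpq).1) ?_ ?_ ?_
      · refine hsub.2 ?_
        rw [← SimpleGraph.Subgraph.mem_edgeSet, SimpleGraph.Walk.mem_edges_toSubgraph,
          SimpleGraph.Walk.edges_concat]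
        simp
      · refine (SimpleGraph.Walk.concat_isPath_iff _).2 ⟨hw, fun hmem => ?_⟩
        obtain ⟨w', h1, h2⟩ := hsup _ hmem
        have := h.injective h2
        subst this
        omega
      · have := h.depth_le q
        simp only [SimpleGraph.Walk.length_concat]; omega
      · intro e he
        rw [SimpleGraph.Walk.darts_concat, List.concat_eq_append, List.mem_append] at he
        rcases he with he | he
        · exact hlen e he
        · rw [List.mem_singleton.1 he]; exact (h.adj p q hpq).2
    refine ⟨?_, ?_⟩
    · rintro _ ⟨p, rfl⟩
      obtain ⟨i, w, hw, hl, hlen, hsup⟩ := h.exists_path _ p rfl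
      refine (hle w hw (hl ▸ h.depth_le p) hlen).1 ?_
      rw [SimpleGraph.Walk.mem_verts_toSubgraph]
      exact w.end_mem_support
    · rintro _ _ ⟨p, q, hpq | hpq, rfl, rfl⟩
      · exact hadj p q hpq
      · exact (hadj q p hpq).symm

/-- Two graphs in which the same forest is embedded, with equal lengths of corresponding edges, have
isomorphic neighborhoods of the roots. -/
theorem isoWithLengths {W : Type} {H : LengthGraph W} {χ : I → W}
    (h : ForestEmbedding root child depth k θ G ψ) (h' : ForestEmbedding root child depth k θ H χ)
    (hlen : ∀ p q, child p q → H.len (χ p) (χ q) = G.len (ψ p) (ψ q)) :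
    IsoWithLengths G (⨆ i, G.nbhd k θ (ψ (root i))) (fun i => ψ (root i))
      H (⨆ i, H.nbhd k θ (χ (root i))) (fun i => χ (root i)) := by
  rw [h.iSup_nbhd, h'.iSup_nbhd]
  obtain ⟨a, ha'⟩ : ∃ a : I ≃ h.image.verts, ∀ p, (a p : V) = ψ p :=
    ⟨Equiv.ofInjective ψ h.injective, fun _ => rfl⟩
  obtain ⟨b, hb'⟩ : ∃ b : I ≃ h'.image.verts, ∀ p, (b p : W) = χ p :=
    ⟨Equiv.ofInjective χ h'.injective, fun _ => rfl⟩
  have hb : ∀ p (x : h.image.verts), ψ p = x → (b (a.symm x) : W) = χ p := fun p x hp => by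
    have : a.symm x = p := by
      rw [Equiv.symm_apply_eq]; exact Subtype.ext (hp.symm.trans (ha' p).symm)
    rw [this, hb']
  refine ⟨⟨a.symm.trans b, ?_⟩, ?_, ?_⟩
  · intro x y
    obtain ⟨p, hp⟩ : ∃ p, ψ p = x := x.2
    obtain ⟨q, hq⟩ : ∃ q, ψ q = y := y.2
    change h'.image.Adj (b (a.symm x)) (b (a.symm y)) ↔ h.image.Adj x y
    rw [hb p x hp, hb q y hq, ← hp, ← hq]
    constructor
    · rintro ⟨p', q', hpq, h1, h2⟩
      rw [h'.injective h1, h'.injective h2] at hpq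
      exact ⟨_, _, hpq, rfl, rfl⟩
    · rintro ⟨p', q', hpq, h1, h2⟩
      rw [h.injective h1, h.injective h2] at hpq
      exact ⟨_, _, hpq, rfl, rfl⟩
  · exact fun i => ⟨⟨root i, rfl⟩, hb _ _ rfl⟩
  · intro x y hadj
    change H.len (b (a.symm x)) (b (a.symm y)) = G.len x y
    obtain ⟨p, q, hpq, h1, h2⟩ := hadj
    rw [hb p x h1, hb q y h2, ← h1, ← h2]
    rcases hpq with hpq | hpq
    · exact hlen _ _ hpq
    · rw [G.len_symm, H.len_symm]
      exact hlen _ _ hpq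

end ForestEmbedding

theorem measurableSet_forall {ι : Sort*} [Countable ι] {α : Type*} [MeasurableSpace α]
    {p : ι → α → Prop} (h : ∀ i, MeasurableSet {x | p i x}) : MeasurableSet {x | ∀ i, p i x} := by
  rw [Set.ofPred_forall]
  exact .iInter h

/-! ### Exponential variables and Poisson points -/

theorem expMeasure_apply {s : Set ℝ} (hs : MeasurableSet s) :
    expMeasure 1 s = ∫⁻ x in s, exponentialPDF 1 x :=
  withDensity_apply _ hs

theorem lintegral_expMeasure {f : ℝ → ℝ≥0∞} (hf : Measurable f) :
    ∫⁻ x, f x ∂expMeasure 1 = ∫⁻ x, exponentialPDF 1 x * f x :=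
  lintegral_withDensity_eq_lintegral_mul _ (measurable_exponentialPDFReal 1).ennreal_ofReal hf

theorem exponentialPDF_one_le (x : ℝ) : exponentialPDF 1 x ≤ ENNReal.ofReal (Real.exp (-x)) := by
  rw [exponentialPDF_eq]
  apply ENNReal.ofReal_le_ofReal
  split_ifs
  · simp
  · positivity

theorem expMeasure_Iic {x : ℝ} (hx : 0 ≤ x) :
    expMeasure 1 (Set.Iic x) = ENNReal.ofReal (1 - Real.exp (-x)) := by
  have h := cdf_expMeasure_eq (r := 1) one_pos x
  rw [if_pos hx, one_mul, cdf_eq_real] at h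
  rw [← h, ofReal_measureReal]

theorem expMeasure_Ioi {x : ℝ} (hx : 0 ≤ x) :
    expMeasure 1 (Set.Ioi x) = ENNReal.ofReal (Real.exp (-x)) := by
  rw [← Set.compl_Iic, prob_compl_eq_one_sub measurableSet_Iic, expMeasure_Iic hx,
    ← ENNReal.ofReal_one, ← ENNReal.ofReal_sub _ (by simpa using hx)]
  simp

theorem ae_pos_expMeasure : ∀ᵐ x ∂expMeasure 1, 0 < x := by
  have h := expMeasure_Iic le_rfl
  rw [ae_iff]
  simpa [Set.Iic] using h

/-- The sequence of points with first point `p.1` and with `p.1 + p.2 i` as the point following the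
`i`-th point. -/
def consShift (p : ℝ × (ℕ → ℝ)) : ℕ → ℝ
  | 0 => p.1
  | i + 1 => p.1 + p.2 i

theorem measurable_consShift : Measurable consShift := by
  refine measurable_pi_lambda _ fun i => ?_
  cases i <;> simp only [consShift] <;> fun_prop

theorem map_cons_infinitePi (μ : Measure ℝ) [IsProbabilityMeasure μ] :
    (μ.prod (Measure.infinitePi fun _ : ℕ => μ)).map (fun p i => Nat.casesOn i p.1 p.2) =
      Measure.infinitePi fun _ : ℕ => μ := by
  have hm : Measurable fun (p : ℝ × (ℕ → ℝ)) (i : ℕ) => (Nat.casesOn i p.1 p.2 : ℝ) := by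
    refine measurable_pi_lambda _ fun i => ?_
    cases i <;> simp only <;> fun_prop
  refine Measure.eq_infinitePi _ fun s t ht => ?_
  classical
  rw [Measure.map_apply hm (MeasurableSet.pi s.countable_toSet fun i _ => ht i)]
  have hpre : (fun (p : ℝ × (ℕ → ℝ)) (i : ℕ) => (Nat.casesOn i p.1 p.2 : ℝ)) ⁻¹' Set.pi s t =
      (if 0 ∈ s then t 0 else Set.univ) ×ˢ
        Set.pi (s.preimage Nat.succ Nat.succ_injective.injOn) fun i => t (i + 1) := by
    ext p
    simp only [Set.mem_preimage, Set.mem_pi, Set.mem_prod, Finset.mem_coe, Finset.mem_preimage]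
    constructor
    · intro h
      refine ⟨?_, fun i hi => h (i + 1) hi⟩
      split_ifs with h0
      · exact h 0 h0
      · trivial
    · rintro ⟨h0, h1⟩ i hi
      cases i with
      | zero => simpa [hi] using h0
      | succ i => exact h1 i hi
  rw [hpre, Measure.prod_prod, Measure.infinitePi_pi _ fun i _ => ht (i + 1)]
  have hprod := Finset.prod_preimage' Nat.succ s Nat.succ_injective.injOn fun i => μ (t i)
  have hfil : s.filter (· ∈ Set.range Nat.succ) = s.erase 0 := by
    ext i
    cases i <;> simp
  rw [hfil] at hprod
  rw [hprod]
  split_ifs with h0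
  · rw [Finset.mul_prod_erase s (fun i => μ (t i)) h0]
  · rw [measure_univ, one_mul, Finset.erase_eq_of_notMem h0]

/-- The renewal property: after the first point, the process starts afresh. All estimates for
Poisson points below are inductions based on this identity. -/
theorem map_consShift_poissonPoints :
    ((expMeasure 1).prod poissonPoints).map consShift = poissonPoints := by
  have hsum : Measurable fun (g : ℕ → ℝ) (i : ℕ) => ∑ j ∈ Finset.range (i + 1), g j := by fun_prop
  have hm : Measurable fun (p : ℝ × (ℕ → ℝ)) (i : ℕ) => (Nat.casesOn i p.1 p.2 : ℝ) := by
    refine measurable_pi_lambda _ fun i => ?_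
    cases i <;> simp only <;> fun_prop
  have h1 : (expMeasure 1).prod poissonPoints =
      ((expMeasure 1).prod (Measure.infinitePi fun _ : ℕ => expMeasure 1)).map
        (Prod.map id fun g i => ∑ j ∈ Finset.range (i + 1), g j) := by
    rw [← Measure.map_prod_map _ _ measurable_id hsum, Measure.map_id]
    rfl
  conv_rhs => rw [poissonPoints, ← map_cons_infinitePi]
  rw [h1, Measure.map_map measurable_consShift (measurable_id.prodMap hsum),
    Measure.map_map hsum hm]
  congr 1
  funext p i
  cases i with
  | zero => simp [consShift]
  | succ i =>
    simp only [Function.comp, consShift, Prod.map, id]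
    rw [Finset.sum_range_succ' _ (i + 1), add_comm]
    rfl

theorem ae_poissonPoints : ∀ᵐ x ∂poissonPoints, 0 < x 0 ∧ StrictMono x := by
  have hsum : Measurable fun (g : ℕ → ℝ) (i : ℕ) => ∑ j ∈ Finset.range (i + 1), g j := by fun_prop
  have hgap : ∀ᵐ g ∂Measure.infinitePi fun _ : ℕ => expMeasure 1, ∀ i, 0 < g i := by
    refine ae_all_iff.2 fun i => ?_
    have h := ae_pos_expMeasure
    rw [← Measure.infinitePi_map_eval (fun _ : ℕ => expMeasure 1) i] at h
    exact ae_of_ae_map (measurable_pi_apply i).aemeasurable h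
  have hset : MeasurableSet {x : ℕ → ℝ | 0 < x 0 ∧ ∀ i, x i < x (i + 1)} := by
    apply MeasurableSet.inter
    · exact measurableSet_lt measurable_const (measurable_pi_apply 0)
    · exact measurableSet_forall fun i =>
        measurableSet_lt (measurable_pi_apply i) (measurable_pi_apply (i + 1))
  have : ∀ᵐ x ∂poissonPoints, 0 < x 0 ∧ ∀ i, x i < x (i + 1) := by
    refine (ae_map_iff hsum.aemeasurable hset).2 ?_
    filter_upwards [hgap] with g hg
    refine ⟨by simpa using hg 0, fun i => ?_⟩
    rw [Finset.sum_range_succ _ (i + 1)]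
    linarith [hg (i + 1)]
  filter_upwards [this] with x hx
  exact ⟨hx.1, strictMono_nat_of_lt_succ hx.2⟩

/-- The density of the points up to `lam` is at most `exp (-lam)`. -/
theorem poissonPoints_box_le (c : ℕ) : ∀ (lam : ℝ) (s : ℕ → Set ℝ), (∀ i, MeasurableSet (s i)) →
    poissonPoints {x | (∀ i < c, x i ≤ lam ∧ x i ∈ s i) ∧ lam < x c} ≤
      ENNReal.ofReal (Real.exp (-lam)) * ∏ i ∈ Finset.range c, volume (s i) := by
  have hmeas : ∀ (c : ℕ) (lam : ℝ) (s : ℕ → Set ℝ), (∀ i, MeasurableSet (s i)) →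
      MeasurableSet {x : ℕ → ℝ | (∀ i < c, x i ≤ lam ∧ x i ∈ s i) ∧ lam < x c} := by
    intro c lam s hs
    apply MeasurableSet.inter
    · exact measurableSet_forall fun i => measurableSet_forall fun _ =>
        (measurableSet_le (measurable_pi_apply i) measurable_const).inter
          (measurable_pi_apply i (hs i))
    · exact measurableSet_lt measurable_const (measurable_pi_apply c)
  induction c with
  | zero =>
    intro lam s hs
    -- Negative `lam` must be allowed, since the induction step uses `lam - g` for every value `g`
    -- of the first point. The bound is then at least `1`.
    rcases lt_or_ge lam 0 with h | h
    · simp only [Finset.range_zero, Finset.prod_empty, mul_one]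
      refine prob_le_one.trans ?_
      rw [← ENNReal.ofReal_one]
      exact ENNReal.ofReal_le_ofReal (Real.one_le_exp (by linarith))
    · rw [← map_consShift_poissonPoints, Measure.map_apply measurable_consShift (hmeas 0 lam s hs)]
      have : consShift ⁻¹' {x | (∀ i < 0, x i ≤ lam ∧ x i ∈ s i) ∧ lam < x 0} =
          Set.Ioi lam ×ˢ Set.univ := by
        ext p; simp [consShift]
      rw [this, Measure.prod_prod, expMeasure_Ioi h]
      simp
  | succ c ih =>
    intro lam s hs
    rw [← map_consShift_poissonPoints,
      Measure.map_apply measurable_consShift (hmeas (c + 1) lam s hs),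
      Measure.prod_apply (measurable_consShift (hmeas (c + 1) lam s hs))]
    -- Given the first point `g`, the others form a shifted copy of the process with threshold `lam
    -- - g`. The density `exp (-g)` of the first point turns `exp (-(lam - g))` into `exp (-lam)`,
    -- and Lebesgue measure absorbs the shift.
    have hslice : ∀ g, poissonPoints (Prod.mk g ⁻¹' (consShift ⁻¹'
        {x | (∀ i < c + 1, x i ≤ lam ∧ x i ∈ s i) ∧ lam < x (c + 1)})) ≤
        (s 0).indicator (fun g => ENNReal.ofReal (Real.exp (-(lam - g))) *
          ∏ i ∈ Finset.range c, volume (s (i + 1))) g := by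
      intro g
      by_cases hg : g ∈ s 0
      · rw [Set.indicator_of_mem hg]
        have h := ih (lam - g) (fun i => (fun y => g + y) ⁻¹' s (i + 1))
          fun i => (measurable_const_add g) (hs (i + 1))
        simp only [measure_preimage_add] at h
        refine le_trans (measure_mono ?_) h
        rintro x ⟨h1, h2⟩
        refine ⟨fun i hi => ⟨?_, (h1 (i + 1) (by omega)).2⟩, ?_⟩
        · have : g + x i ≤ lam := (h1 (i + 1) (by omega)).1
          linarith
        · have : lam < g + x c := h2
          linarith
      · have : Prod.mk g ⁻¹' (consShift ⁻¹'
            {x | (∀ i < c + 1, x i ≤ lam ∧ x i ∈ s i) ∧ lam < x (c + 1)}) = ∅ := by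
          ext x
          simp only [Set.mem_preimage, Set.mem_ofPred_eq, Set.mem_empty_iff_false, iff_false]
          rintro ⟨h1, -⟩
          exact hg (h1 0 (by omega)).2
        rw [this]
        simp
    refine (lintegral_mono hslice).trans ?_
    rw [lintegral_expMeasure]
    swap
    · exact Measurable.indicator (by fun_prop) (hs 0)
    rw [Finset.prod_range_succ']
    set K := ∏ i ∈ Finset.range c, volume (s (i + 1))
    calc _ ≤ ∫⁻ x, (s 0).indicator (fun _ => ENNReal.ofReal (Real.exp (-lam)) * K) x := by
          refine lintegral_mono fun x => ?_
          by_cases hx : x ∈ s 0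
          · simp only [Set.indicator_of_mem hx]
            rw [← mul_assoc]
            gcongr
            refine (mul_le_mul_left (exponentialPDF_one_le x) _).trans ?_
            rw [← ENNReal.ofReal_mul (by positivity), ← Real.exp_add]
            apply le_of_eq
            congr 2
            ring
          · simp [hx]
      _ = ENNReal.ofReal (Real.exp (-lam)) * (K * volume (s 0)) := by
          rw [lintegral_indicator (hs 0), lintegral_const, Measure.restrict_apply MeasurableSet.univ,
            Set.univ_inter, mul_assoc]

/-- The bound `lam` for the number of points reproduces itself when one conditions on the first
point `g`. For `lam ≥ 0`, the integrand `exp (-g) * (1 + (lam - g))` on `[0, lam]` has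
antiderivative `-(exp (-g) * (lam - g))`. -/
theorem lintegral_expMeasure_renewal (lam : ℝ) :
    ∫⁻ g, ((Set.Iic lam).indicator 1 g + ENNReal.ofReal (lam - g)) ∂expMeasure 1 ≤
      ENNReal.ofReal lam := by
  have hmi : Measurable ((Set.Iic lam).indicator (1 : ℝ → ℝ≥0∞)) :=
    measurable_one.indicator measurableSet_Iic
  rw [lintegral_expMeasure (f := fun g => (Set.Iic lam).indicator 1 g + ENNReal.ofReal (lam - g))
    (hmi.add (by fun_prop))]
  have hpt : ∀ g, exponentialPDF 1 g * ((Set.Iic lam).indicator 1 g + ENNReal.ofReal (lam - g)) =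
      (Set.Icc 0 lam).indicator
        (fun g => ENNReal.ofReal (Real.exp (-g) * (1 + (lam - g)))) g := by
    intro g
    by_cases h : g ∈ Set.Icc 0 lam
    · rw [Set.indicator_of_mem h, Set.indicator_of_mem (show g ∈ Set.Iic lam from h.2),
        exponentialPDF_of_nonneg h.1, Pi.one_apply, ← ENNReal.ofReal_one,
        ← ENNReal.ofReal_add (by norm_num) (by linarith [h.2]), ← ENNReal.ofReal_mul (by positivity)]
      simp
    · rw [Set.indicator_of_notMem h]
      by_cases h0 : 0 ≤ g
      · have hl : lam < g := by
          by_contra hcon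
          exact h ⟨h0, not_lt.1 hcon⟩
        rw [Set.indicator_of_notMem (by simpa using hl), ENNReal.ofReal_of_nonpos (by linarith)]
        simp
      · rw [exponentialPDF_of_neg (not_le.1 h0), zero_mul]
  simp_rw [hpt]
  rw [lintegral_indicator measurableSet_Icc]
  rcases lt_or_ge lam 0 with hl | hl
  · rw [Set.Icc_eq_empty (by linarith)]
    simp
  have hcont : Continuous fun g : ℝ => Real.exp (-g) * (1 + (lam - g)) := by fun_prop
  rw [← ofReal_integral_eq_lintegral_ofReal (hcont.integrableOn_Icc)]
  · rw [integral_Icc_eq_integral_Ioc, ← intervalIntegral.integral_of_le hl,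
      intervalIntegral.integral_eq_sub_of_hasDerivAt (f := fun g => -(Real.exp (-g) * (lam - g)))]
    · simp
    · intro x _
      have h1 : HasDerivAt (fun g : ℝ => Real.exp (-g)) (Real.exp (-x) * -1) x :=
        (hasDerivAt_neg x).exp
      have h2 : HasDerivAt (fun g : ℝ => lam - g) (-1) x := by
        simpa using (hasDerivAt_id x).const_sub lam
      convert! (h1.mul h2).neg using 1
      ring
    · exact hcont.intervalIntegrable _ _
  · refine (ae_restrict_mem measurableSet_Icc).mono fun x hx => ?_
    have : 0 ≤ lam - x := by linarith [hx.2]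
    simp only [Pi.zero_apply]
    positivity

/-- The expected number of points up to `lam` is at most `lam`. -/
theorem sum_poissonPoints_le (N : ℕ) : ∀ lam : ℝ,
    ∑ i ∈ Finset.range N, poissonPoints {x | x i ≤ lam} ≤ ENNReal.ofReal lam := by
  induction N with
  | zero => simp
  | succ N ih =>
    intro lam
    have hms : ∀ i : ℕ, MeasurableSet {x : ℕ → ℝ | x i ≤ lam} := fun i =>
      measurableSet_le (measurable_pi_apply i) measurable_const
    have h0 : poissonPoints {x | x 0 ≤ lam} =
        ∫⁻ g, (Set.Iic lam).indicator 1 g ∂expMeasure 1 := by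
      rw [← map_consShift_poissonPoints, Measure.map_apply measurable_consShift (hms 0),
        lintegral_indicator_one measurableSet_Iic]
      have : consShift ⁻¹' {x | x 0 ≤ lam} = Set.Iic lam ×ˢ Set.univ := by
        ext p; simp [consShift]
      rw [this, Measure.prod_prod, measure_univ, mul_one]
    have hi : ∀ i, poissonPoints {x | x (i + 1) ≤ lam} =
        ∫⁻ g, poissonPoints {x | x i ≤ lam - g} ∂expMeasure 1 := by
      intro i
      rw [← map_consShift_poissonPoints, Measure.map_apply measurable_consShift (hms (i + 1)),
        Measure.prod_apply (measurable_consShift (hms (i + 1))), map_consShift_poissonPoints]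
      refine lintegral_congr fun g => ?_
      congr 1
      ext x
      simp only [consShift, Set.mem_preimage, Set.mem_ofPred_eq]
      constructor <;> intro h <;> linarith
    have hmeas : ∀ i : ℕ, Measurable fun g : ℝ => poissonPoints {x | x i ≤ lam - g} := by
      intro i
      have : MeasurableSet {p : ℝ × (ℕ → ℝ) | p.2 i ≤ lam - p.1} :=
        measurableSet_le (by fun_prop) (by fun_prop)
      exact measurable_measure_prodMk_left this
    rw [Finset.sum_range_succ', h0]
    simp_rw [hi]
    rw [← lintegral_finsetSum _ fun i _ => hmeas i, add_comm,
      ← lintegral_add_left (measurable_one.indicator measurableSet_Iic)]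
    refine (lintegral_mono fun g => ?_).trans (lintegral_expMeasure_renewal lam)
    gcongr
    exact ih _

theorem tsum_poissonPoints_le (lam : ℝ) :
    ∑' i, poissonPoints {x | x i ≤ lam} ≤ ENNReal.ofReal lam :=
  ENNReal.tsum_le_of_sum_range_le fun N => sum_poissonPoints_le N lam

/-! ### Shapes of neighborhoods and their labellings -/

/-- `V` is the vertex set of a possible union of neighborhoods in a disjoint union of `m` trees. -/
structure IsShape (k : ℕ) {m : ℕ} (V : Finset (Fin m × List ℕ)) : Prop where
  root_mem : ∀ i, (i, []) ∈ V
  parent_mem : ∀ {i a u}, (i, a :: u) ∈ V → (i, u) ∈ V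
  length_le : ∀ {i u}, (i, u) ∈ V → u.length ≤ k
  lower : ∀ {i a b u}, b ≤ a → (i, a :: u) ∈ V → (i, b :: u) ∈ V

/-- The vertices of a shape other than the roots, which correspond to its edges. -/
def nonroots {m : ℕ} (V : Finset (Fin m × List ℕ)) : Finset (Fin m × List ℕ) :=
  V.filter fun w => w.2 ≠ []

theorem cons_mem_nonroots {m : ℕ} {V : Finset (Fin m × List ℕ)} {i a u} :
    (i, a :: u) ∈ nonroots V ↔ (i, a :: u) ∈ V := by
  simp [nonroots]

/-- Injective labellings of a shape by vertices of `K_n` in which the roots have given labels. -/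
def Labelling {n m : ℕ} (v : Fin m → Fin n) (V : Finset (Fin m × List ℕ)) : Type :=
  {lab : {w // w ∈ V} → Fin n // Function.Injective lab ∧ ∀ i h, lab ⟨(i, []), h⟩ = v i}

instance {n m : ℕ} (v : Fin m → Fin n) (V : Finset (Fin m × List ℕ)) : Finite (Labelling v V) :=
  inferInstanceAs (Finite (Subtype _))

/-- The set of trees whose neighborhoods of the roots have the shape `V`. -/
def treeEvent (k : ℕ) (θ : ℝ) {m : ℕ} (V : Finset (Fin m × List ℕ)) :
    Set (Fin m → List ℕ → ℕ → ℝ) :=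
  {t | ∀ i u, (i, u) ∈ V → u.length < k →
    (0 < t i u 0 ∧ StrictMono (t i u)) ∧ ∀ a, t i u a ≤ θ ↔ (i, a :: u) ∈ V}

/-- The lengths of the edges of a shape. -/
def treeLengths {m : ℕ} (V : Finset (Fin m × List ℕ)) (t : Fin m → List ℕ → ℕ → ℝ) :
    {w // w ∈ nonroots V} → ℝ :=
  fun w => parentEdge (t w.1.1) w.1.2

theorem measurable_parentEdge (u : List ℕ) :
    Measurable fun t : List ℕ → ℕ → ℝ => parentEdge t u := by
  cases u <;> simp only [parentEdge] <;> fun_prop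

theorem measurable_treeLengths {m : ℕ} (V : Finset (Fin m × List ℕ)) :
    Measurable (treeLengths V) :=
  measurable_pi_lambda _ fun w => (measurable_parentEdge w.1.2).comp (measurable_pi_apply w.1.1)

theorem measurableSet_strictMono : MeasurableSet {x : ℕ → ℝ | StrictMono x} := by
  have : {x : ℕ → ℝ | StrictMono x} = {x | ∀ i, x i < x (i + 1)} := by
    ext x
    exact ⟨fun h i => h (Nat.lt_succ_self i), strictMono_nat_of_lt_succ⟩
  rw [this]
  exact measurableSet_forall fun i => measurableSet_lt (by fun_prop) (by fun_prop)

theorem measurableSet_treeEvent (k : ℕ) (θ : ℝ) {m : ℕ} (V : Finset (Fin m × List ℕ)) :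
    MeasurableSet (treeEvent k θ V) := by
  refine measurableSet_forall fun i => measurableSet_forall fun u => measurableSet_forall fun _ =>
    measurableSet_forall fun _ => MeasurableSet.inter (MeasurableSet.inter ?_ ?_) ?_
  · exact (show Measurable fun t : Fin m → List ℕ → ℕ → ℝ => t i u 0 by fun_prop) measurableSet_Ioi
  · exact (show Measurable fun t : Fin m → List ℕ → ℕ → ℝ => t i u by fun_prop)
      measurableSet_strictMono
  · refine measurableSet_forall fun a => ?_
    have h : MeasurableSet {t : Fin m → List ℕ → ℕ → ℝ | t i u a ≤ θ} :=
      measurableSet_le (by fun_prop) (by fun_prop)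
    by_cases hm : (i, a :: u) ∈ V
    · simpa [hm] using h
    · have : {t : Fin m → List ℕ → ℕ → ℝ | t i u a ≤ θ ↔ (i, a :: u) ∈ V} = {t | t i u a ≤ θ}ᶜ := by
        ext t
        simp [hm]
      exact this ▸ h.compl

/-- The tree determines its shape: by induction on depth, a child of a common vertex belongs to
either shape exactly when its edge has length at most `θ`. -/
theorem treeEvent_disjoint {k : ℕ} {θ : ℝ} {m : ℕ} {V V' : Finset (Fin m × List ℕ)}
    (hV : IsShape k V) (hV' : IsShape k V') {t : Fin m → List ℕ → ℕ → ℝ}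
    (ht : t ∈ treeEvent k θ V) (ht' : t ∈ treeEvent k θ V') : V = V' := by
  have : ∀ u i, (i, u) ∈ V ↔ (i, u) ∈ V' := by
    intro u
    induction u with
    | nil => exact fun i => iff_of_true (hV.root_mem i) (hV'.root_mem i)
    | cons a u ih =>
      intro i
      constructor
      · intro h
        have hp := hV.parent_mem h
        have hl : u.length < k := hV.length_le h
        exact ((ht' i u ((ih i).1 hp) hl).2 a).1 (((ht i u hp hl).2 a).2 h)
      · intro h
        have hp := hV'.parent_mem h
        have hl : u.length < k := hV'.length_le h
        exact ((ht i u ((ih i).2 hp) hl).2 a).1 (((ht' i u hp hl).2 a).2 h)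
  ext ⟨i, u⟩
  exact this u i

/-- The parent-child relation of a shape. -/
def IsChild {m : ℕ} {V : Finset (Fin m × List ℕ)} (p q : {w // w ∈ V}) : Prop :=
  q.1.1 = p.1.1 ∧ ∃ a, q.1.2 = a :: p.1.2

theorem forestEmbedding_tree {k : ℕ} {θ : ℝ} {m : ℕ} {V : Finset (Fin m × List ℕ)}
    (hV : IsShape k V) {t : Fin m → List ℕ → ℕ → ℝ} (ht : t ∈ treeEvent k θ V) :
    ForestEmbedding (fun i => (⟨(i, []), hV.root_mem i⟩ : {w // w ∈ V})) IsChild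
      (fun p => p.1.2.length) k θ (LengthGraph.disjointUnion fun i => treeLengthGraph (t i))
      Subtype.val where
  depth_root _ := rfl
  depth_child := by
    rintro p q ⟨-, a, ha⟩
    simp [ha]
  depth_le p := hV.length_le p.2
  exists_parent := by
    rintro ⟨⟨i, u⟩, h⟩
    cases u with
    | nil => exact .inl ⟨i, rfl⟩
    | cons a u => exact .inr ⟨⟨(i, u), hV.parent_mem h⟩, rfl, a, rfl⟩
  injective := Subtype.val_injective
  adj := by
    rintro ⟨⟨i, u⟩, h⟩ ⟨⟨j, w⟩, h'⟩ ⟨rfl : j = i, a, rfl : w = a :: u⟩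
    refine ⟨⟨rfl, .inl ⟨a, rfl⟩⟩, ?_⟩
    simp only [LengthGraph.disjointUnion, treeLengthGraph, List.length_cons, if_true,
      Nat.lt_succ_self, parentEdge]
    exact ((ht j u h (hV.length_le h')).2 a).2 h'
  exists_of_adj := by
    rintro ⟨⟨i, u⟩, h⟩ ⟨j, w⟩ hd hadj hlen
    obtain ⟨rfl : i = j, ⟨a, rfl : w = a :: u⟩ | ⟨a, rfl : u = a :: w⟩⟩ := hadj
    · simp only [LengthGraph.disjointUnion, treeLengthGraph, List.length_cons, if_true,
        Nat.lt_succ_self, parentEdge] at hlen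
      exact ⟨⟨_, ((ht i u h hd).2 a).1 hlen⟩, .inl ⟨rfl, a, rfl⟩, rfl⟩
    · exact ⟨⟨_, hV.parent_mem h⟩, .inr ⟨rfl, a, rfl⟩, rfl⟩

/-- The parent of a vertex of a shape other than a root. -/
def parent {k m : ℕ} {V : Finset (Fin m × List ℕ)} (hV : IsShape k V) (w : {w // w ∈ nonroots V}) :
    {w // w ∈ V} :=
  ⟨(w.1.1, w.1.2.tail), by
    obtain ⟨⟨i, u⟩, h⟩ := w
    cases u with
    | nil => simp [nonroots] at h
    | cons a u => exact hV.parent_mem (cons_mem_nonroots.1 h)⟩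

/-- A vertex of a shape other than a root, as a vertex of the shape. -/
def toVertex {m : ℕ} {V : Finset (Fin m × List ℕ)} (w : {w // w ∈ nonroots V}) : {w // w ∈ V} :=
  ⟨w.1, (Finset.mem_filter.1 w.2).1⟩

theorem isChild_parent {k m : ℕ} {V : Finset (Fin m × List ℕ)} (hV : IsShape k V)
    (w : {w // w ∈ nonroots V}) : IsChild (parent hV w) (toVertex w) := by
  obtain ⟨⟨i, u⟩, h⟩ := w
  cases u with
  | nil => simp [nonroots] at h
  | cons a u => exact ⟨rfl, a, rfl⟩

theorem exists_of_isChild {k m : ℕ} {V : Finset (Fin m × List ℕ)} (hV : IsShape k V)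
    {p q : {w // w ∈ V}} (h : IsChild p q) : ∃ w, parent hV w = p ∧ toVertex w = q := by
  obtain ⟨⟨i, u⟩, hp⟩ := p
  obtain ⟨⟨j, w⟩, hq⟩ := q
  obtain ⟨rfl : j = i, a, rfl : w = a :: u⟩ := h
  exact ⟨⟨(j, a :: u), cons_mem_nonroots.2 hq⟩, rfl, rfl⟩

theorem IsChild.ne {m : ℕ} {V : Finset (Fin m × List ℕ)} {p q : {w // w ∈ V}} (h : IsChild p q) :
    p ≠ q := by
  rintro rfl
  obtain ⟨-, a, ha⟩ := h
  simpa using congrArg List.length ha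

section Labelled

variable {k n m : ℕ} {v : Fin m → Fin n} {V : Finset (Fin m × List ℕ)}

/-- The edge of `K_n` that corresponds to an edge of a labelled shape. -/
def edge (hV : IsShape k V) (lab : Labelling v V) (w : {w // w ∈ nonroots V}) : Edges n :=
  ⟨s(lab.1 (parent hV w), lab.1 (toVertex w)), by
    simpa using fun h => (isChild_parent hV w).ne (lab.2.1 h)⟩

/-- An edge determines its deeper end. If two edges agreed with ends exchanged, each child would be
the parent of the other, against the depths. -/
theorem edge_injective (hV : IsShape k V) (lab : Labelling v V) :
    Function.Injective (edge hV lab) := by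
  intro w w' h
  have h' : s(lab.1 (parent hV w), lab.1 (toVertex w)) =
    s(lab.1 (parent hV w'), lab.1 (toVertex w')) := congrArg Subtype.val h
  obtain ⟨-, a, ha⟩ := isChild_parent hV w
  obtain ⟨-, a', ha'⟩ := isChild_parent hV w'
  rw [Sym2.eq_iff] at h'
  rcases h' with ⟨-, h2⟩ | ⟨h1, h2⟩
  · exact Subtype.ext (congrArg Subtype.val (lab.2.1 h2) :)
  · have e1 := lab.2.1 h1
    have e2 := lab.2.1 h2
    rw [e1] at ha
    rw [← e2] at ha'
    have := congrArg List.length ha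
    have := congrArg List.length ha'
    simp only [List.length_cons] at *
    omega

theorem len_edge (hV : IsShape k V) (lab : Labelling v V) (w : {w // w ∈ nonroots V})
    (l : Edges n → ℝ) :
    (completeLengthGraph l).len (lab.1 (parent hV w)) (lab.1 (toVertex w)) = l (edge hV lab w) :=
  dif_pos fun h => (isChild_parent hV w).ne (lab.2.1 h)

/-- The edges of `K_n` that have an end with a label of depth less than `k`. -/
def touching (k : ℕ) (lab : Labelling v V) : Set (Edges n) :=
  {e | ∃ p : {w // w ∈ V}, p.1.2.length < k ∧ lab.1 p ∈ e.1}

/-- The condition on edge lengths of `K_n` that every edge of the labelled shape has length at most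
`θ`, while every other edge that has an end of depth less than `k` is longer. -/
def boxEvent (θ : ℝ) (hV : IsShape k V) (lab : Labelling v V) : Set (Edges n → ℝ) :=
  {l | (∀ w, l (edge hV lab w) ∈ Set.Ioc 0 θ) ∧
    ∀ e ∈ touching k lab, e ∉ Set.range (edge hV lab) → θ < l e}

/-- The condition on lengths of the edges of a shape that siblings are in increasing order. -/
def ordered (V : Finset (Fin m × List ℕ)) : Set ({w // w ∈ nonroots V} → ℝ) :=
  {z | ∀ w w' : {w // w ∈ nonroots V}, w.1.1 = w'.1.1 → w.1.2.tail = w'.1.2.tail →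
    w.1.2.headI < w'.1.2.headI → z w < z w'}

/-- The lengths of the edges of `K_n` that correspond to the edges of a labelled shape. -/
def graphLengths (hV : IsShape k V) (lab : Labelling v V) (l : Edges n → ℝ) :
    {w // w ∈ nonroots V} → ℝ :=
  fun w => l (edge hV lab w)

/-- The set of edge lengths of `K_n` for which the neighborhoods of the given vertices have the given
labelled shape. -/
def graphEvent (θ : ℝ) (hV : IsShape k V) (lab : Labelling v V) : Set (Edges n → ℝ) :=
  boxEvent θ hV lab ∩ graphLengths hV lab ⁻¹' ordered V

theorem measurable_graphLengths (hV : IsShape k V) (lab : Labelling v V) :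
    Measurable (graphLengths hV lab) :=
  measurable_pi_lambda _ fun _ => measurable_pi_apply _

theorem measurableSet_ordered (V : Finset (Fin m × List ℕ)) : MeasurableSet (ordered V) :=
  measurableSet_forall fun _ => measurableSet_forall fun _ => measurableSet_forall fun _ =>
    measurableSet_forall fun _ => measurableSet_forall fun _ =>
      measurableSet_lt (by fun_prop) (by fun_prop)

theorem measurableSet_boxEvent (θ : ℝ) (hV : IsShape k V) (lab : Labelling v V) :
    MeasurableSet (boxEvent θ hV lab) :=
  (measurableSet_forall fun _ => (measurable_pi_apply _) measurableSet_Ioc).inter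
    (measurableSet_forall fun _ => measurableSet_forall fun _ => measurableSet_forall fun _ =>
      measurableSet_lt (by fun_prop) (by fun_prop))

theorem measurableSet_graphEvent (θ : ℝ) (hV : IsShape k V) (lab : Labelling v V) :
    MeasurableSet (graphEvent θ hV lab) :=
  (measurableSet_boxEvent θ hV lab).inter
    (measurable_graphLengths hV lab (measurableSet_ordered V))

/-- Only `boxEvent` is needed here; the order of siblings serves solely to make the labelled shape
unique. -/
theorem forestEmbedding_graph {θ : ℝ} (hV : IsShape k V) (lab : Labelling v V) {l : Edges n → ℝ}
    (hl : l ∈ boxEvent θ hV lab) :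
    ForestEmbedding (fun i => (⟨(i, []), hV.root_mem i⟩ : {w // w ∈ V})) IsChild
      (fun p => p.1.2.length) k θ (completeLengthGraph l) lab.1 where
  depth_root _ := rfl
  depth_child := by
    rintro p q ⟨-, a, ha⟩
    simp [ha]
  depth_le p := hV.length_le p.2
  exists_parent := by
    rintro ⟨⟨i, u⟩, h⟩
    cases u with
    | nil => exact .inl ⟨i, rfl⟩
    | cons a u => exact .inr ⟨⟨(i, u), hV.parent_mem h⟩, rfl, a, rfl⟩
  injective := lab.2.1
  adj p q h := by
    refine ⟨fun he => h.ne (lab.2.1 he), ?_⟩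
    obtain ⟨w, rfl, rfl⟩ := exists_of_isChild hV h
    rw [len_edge]
    exact (hl.1 w).2
  exists_of_adj p y hd hadj hlen := by
    have hne : lab.1 p ≠ y := hadj
    have hlen' : l ⟨s(lab.1 p, y), by simpa using hne⟩ ≤ θ := by
      have h : (completeLengthGraph l).len (lab.1 p) y = l ⟨s(lab.1 p, y), by simpa using hne⟩ :=
        dif_pos hne
      rwa [h] at hlen
    by_cases hr : (⟨s(lab.1 p, y), by simpa using hne⟩ : Edges n) ∈ Set.range (edge hV lab)
    · obtain ⟨w, hw⟩ := hr
      have h' : s(lab.1 (parent hV w), lab.1 (toVertex w)) = s(lab.1 p, y) :=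
        congrArg Subtype.val hw
      have hc := isChild_parent hV w
      rw [Sym2.eq_iff] at h'
      rcases h' with ⟨h1, h2⟩ | ⟨h1, h2⟩
      · rw [lab.2.1 h1] at hc
        exact ⟨_, .inl hc, h2⟩
      · rw [lab.2.1 h2] at hc
        exact ⟨_, .inr hc, h1⟩
    · exact absurd hlen' (not_le.2 (hl.2 _ ⟨p, hd, by simp⟩ hr))

theorem nbhdsIsomorphic {θ : ℝ} (hV : IsShape k V) (lab : Labelling v V) {l : Edges n → ℝ}
    {t : Fin m → List ℕ → ℕ → ℝ} (ht : t ∈ treeEvent k θ V) (hl : l ∈ graphEvent θ hV lab)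
    (h : treeLengths V t = graphLengths hV lab l) : NbhdsIsomorphic k θ v l t := by
  have key := (forestEmbedding_graph hV lab hl.1).isoWithLengths (forestEmbedding_tree hV ht) ?_
  · simp only [lab.2.2] at key
    exact key
  · intro p q hpq
    obtain ⟨w, rfl, rfl⟩ := exists_of_isChild hV hpq
    rw [len_edge]
    refine Eq.trans ?_ (congrFun h w)
    obtain ⟨⟨i, u⟩, hw⟩ := w
    cases u with
    | nil => simp [nonroots] at hw
    | cons a u =>
      simp [LengthGraph.disjointUnion, treeLengthGraph, treeLengths, parent, toVertex]

end Labelled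

/-! ### Disjointness of the graph events -/

/-- Two enumerations of the same set in increasing order of `F` agree. -/
theorem enumeration_unique {X : Type} {F : X → ℝ} {C C' : ℕ → Prop}
    (hC : ∀ {a b}, b ≤ a → C a → C b) (hC' : ∀ {a b}, b ≤ a → C' a → C' b)
    {x : ∀ a, C a → X} {x' : ∀ a, C' a → X}
    (hx : ∀ {a b} (ha : C a) (hb : C b), a < b → F (x a ha) < F (x b hb))
    (hx' : ∀ {a b} (ha : C' a) (hb : C' b), a < b → F (x' a ha) < F (x' b hb))
    (h : ∀ y, (∃ a ha, x a ha = y) ↔ ∃ a ha, x' a ha = y) (a : ℕ) :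
    (C a ↔ C' a) ∧ ∀ ha ha', x a ha = x' a ha' := by
  -- Half of the induction step, stated for an arbitrary pair of enumerations so that it can be
  -- applied with their roles exchanged.
  have main : ∀ {C C' : ℕ → Prop} (_ : ∀ {a b}, b ≤ a → C a → C b)
      (_ : ∀ {a b}, b ≤ a → C' a → C' b) {x : ∀ a, C a → X} {x' : ∀ a, C' a → X}
      (_ : ∀ {a b} (ha : C a) (hb : C b), a < b → F (x a ha) < F (x b hb))
      (_ : ∀ {a b} (ha : C' a) (hb : C' b), a < b → F (x' a ha) < F (x' b hb))
      (_ : ∀ y, (∃ a ha, x a ha = y) ↔ ∃ a ha, x' a ha = y) (a : ℕ)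
      (_ : ∀ b < a, (C b ↔ C' b) ∧ ∀ hb hb', x b hb = x' b hb') (ha : C a),
      ∃ ha', x a ha = x' a ha' := by
    intro C C' hC hC' x x' hx hx' h a ih ha
    obtain ⟨a', ha', e⟩ := (h _).1 ⟨a, ha, rfl⟩
    rcases lt_trichotomy a' a with hlt | rfl | hlt
    · have h1 := hx ((ih a' hlt).1.2 ha') ha hlt
      rw [(ih a' hlt).2 _ ha', e] at h1
      exact absurd h1 (lt_irrefl _)
    · exact ⟨ha', e.symm⟩
    · have ha2 := hC' hlt.le ha'
      obtain ⟨a'', ha'', e'⟩ := (h _).2 ⟨a, ha2, rfl⟩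
      have h1 := hx' ha2 ha' hlt
      rw [e, ← e'] at h1
      rcases lt_trichotomy a'' a with hlt' | rfl | hlt'
      · have h2 := hx' ((ih a'' hlt').1.1 ha'') ha2 hlt'
        rw [← (ih a'' hlt').2 ha'', e'] at h2
        exact absurd h2 (lt_irrefl _)
      · exact absurd h1 (lt_irrefl _)
      · exact absurd h1 (hx ha ha'' hlt').not_gt
  induction a using Nat.strong_induction_on with
  | _ a ih =>
    have h1 := main hC hC' hx hx' h a ih
    have h2 := main hC' hC hx' hx (fun y => (h y).symm) a
      fun b hb => ⟨(ih b hb).1.symm, fun p q => ((ih b hb).2 q p).symm⟩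
    refine ⟨⟨fun ha => (h1 ha).1, fun ha => (h2 ha).1⟩, fun ha ha' => (h1 ha).2⟩

/-- The children of an inner vertex are its neighbors at length at most `θ` other than its parent.
Hence their labels depend only on `l` and on the labels of the vertex and its parent. -/
theorem mem_children_iff {k n m : ℕ} {v : Fin m → Fin n} {V : Finset (Fin m × List ℕ)} {θ : ℝ}
    (hV : IsShape k V) (lab : Labelling v V) {l : Edges n → ℝ} (hl : l ∈ boxEvent θ hV lab)
    {i : Fin m} {u : List ℕ} (h : (i, u) ∈ V) (hu : u.length < k) (y : Fin n) :
    (∃ a, ∃ ha : (i, a :: u) ∈ V, lab.1 ⟨(i, a :: u), ha⟩ = y) ↔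
      lab.1 ⟨(i, u), h⟩ ≠ y ∧ (completeLengthGraph l).len (lab.1 ⟨(i, u), h⟩) y ≤ θ ∧
        ∀ w, IsChild w ⟨(i, u), h⟩ → lab.1 w ≠ y := by
  have hE := forestEmbedding_graph hV lab hl
  constructor
  · rintro ⟨a, ha, rfl⟩
    have hc : IsChild (⟨(i, u), h⟩ : {w // w ∈ V}) ⟨(i, a :: u), ha⟩ := ⟨rfl, a, rfl⟩
    refine ⟨fun he => hc.ne (lab.2.1 he), (hE.adj _ _ hc).2, fun w hw he => ?_⟩
    have h1 := hE.depth_child _ _ hc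
    have h2 := hE.depth_child _ _ hw
    rw [lab.2.1 he] at h2
    omega
  · rintro ⟨h1, h2, h3⟩
    obtain ⟨⟨⟨j, w⟩, hq⟩, hc, rfl⟩ := hE.exists_of_adj _ _ hu h1 h2
    rcases hc with ⟨rfl : j = i, a, rfl : w = a :: u⟩ | hc
    · exact ⟨a, hq, rfl⟩
    · exact absurd rfl (h3 _ hc)

/-- By `mem_children_iff`, both labelled shapes give a vertex the same set of child labels, and both
list that set by increasing length. The induction is strong because the parent of the vertex, two
generations above its children, also matters. -/
theorem graphEvent_unique {k n m : ℕ} {v : Fin m → Fin n} {V V' : Finset (Fin m × List ℕ)} {θ : ℝ}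
    (hV : IsShape k V) (hV' : IsShape k V') (lab : Labelling v V) (lab' : Labelling v V')
    {l : Edges n → ℝ} (hl : l ∈ graphEvent θ hV lab) (hl' : l ∈ graphEvent θ hV' lab')
    (i : Fin m) (N : ℕ) : ∀ u : List ℕ, u.length = N →
      ((i, u) ∈ V ↔ (i, u) ∈ V') ∧ ∀ h h', lab.1 ⟨(i, u), h⟩ = lab'.1 ⟨(i, u), h'⟩ := by
  induction N using Nat.strong_induction_on with
  | _ N ih =>
    intro u hN
    cases u with
    | nil =>
      refine ⟨iff_of_true (hV.root_mem i) (hV'.root_mem i), fun h h' => ?_⟩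
      rw [lab.2.2, lab'.2.2]
    | cons a u =>
      rw [List.length_cons] at hN
      obtain ⟨hmem, hlab⟩ := ih u.length (by omega) u rfl
      by_cases hu : (i, u) ∈ V
      swap
      · have hu' : (i, u) ∉ V' := fun h => hu (hmem.2 h)
        exact ⟨iff_of_false (fun h => hu (hV.parent_mem h)) fun h => hu' (hV'.parent_mem h),
          fun h => absurd (hV.parent_mem h) hu⟩
      have hu' := hmem.1 hu
      by_cases hk : u.length < k
      swap
      · exact ⟨iff_of_false (fun h => hk (hV.length_le h)) fun h => hk (hV'.length_le h),
          fun h => absurd (hV.length_le h) hk⟩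
      refine enumeration_unique (F := (completeLengthGraph l).len (lab.1 ⟨(i, u), hu⟩))
        (C := fun a => (i, a :: u) ∈ V) (C' := fun a => (i, a :: u) ∈ V')
        (x := fun a ha => lab.1 ⟨(i, a :: u), ha⟩) (x' := fun a ha => lab'.1 ⟨(i, a :: u), ha⟩)
        hV.lower hV'.lower ?_ ?_ ?_ a
      · intro a b ha hb hab
        have e1 := len_edge hV lab ⟨(i, a :: u), cons_mem_nonroots.2 ha⟩ l
        have e2 := len_edge hV lab ⟨(i, b :: u), cons_mem_nonroots.2 hb⟩ l
        refine (e1.trans_lt ?_).trans_eq e2.symm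
        exact hl.2 _ _ rfl rfl hab
      · intro a b ha hb hab
        rw [hlab hu hu']
        have e1 := len_edge hV' lab' ⟨(i, a :: u), cons_mem_nonroots.2 ha⟩ l
        have e2 := len_edge hV' lab' ⟨(i, b :: u), cons_mem_nonroots.2 hb⟩ l
        refine (e1.trans_lt ?_).trans_eq e2.symm
        exact hl'.2 _ _ rfl rfl hab
      · intro y
        rw [mem_children_iff hV lab hl.1 hu hk, mem_children_iff hV' lab' hl'.1 hu' hk, hlab hu hu']
        refine and_congr Iff.rfl (and_congr Iff.rfl ?_)
        cases u with
        | nil =>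
          refine iff_of_true ?_ ?_ <;>
          · rintro w ⟨-, b, hb⟩
            simp at hb
        | cons b u =>
          have hw := (ih u.length (by simp at hN; omega) u rfl).2 (hV.parent_mem hu)
            (hV'.parent_mem hu')
          constructor
          · rintro h ⟨⟨j, w⟩, hm⟩ ⟨rfl : i = j, b', hb : b :: u = b' :: w⟩
            obtain ⟨rfl, rfl⟩ := List.cons.inj hb
            rw [← hw]
            exact h _ ⟨rfl, b, rfl⟩
          · rintro h ⟨⟨j, w⟩, hm⟩ ⟨rfl : i = j, b', hb : b :: u = b' :: w⟩
            obtain ⟨rfl, rfl⟩ := List.cons.inj hb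
            rw [hw]
            exact h _ ⟨rfl, b, rfl⟩

/-- A shape together with a labelling. -/
abbrev LabelledShape (k : ℕ) {n m : ℕ} (v : Fin m → Fin n) : Type :=
  Σ V : {V : Finset (Fin m × List ℕ) // IsShape k V}, Labelling v V.1

theorem graphEvent_disjoint (k : ℕ) {n m : ℕ} (v : Fin m → Fin n) (θ : ℝ) :
    Pairwise (Function.onFun Disjoint fun x : LabelledShape k v => graphEvent θ x.1.2 x.2) := by
  rintro ⟨⟨V, hV⟩, lab⟩ ⟨⟨V', hV'⟩, lab'⟩ hne
  refine Set.disjoint_left.2 fun l hl hl' => hne ?_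
  have h := fun (p : Fin m × List ℕ) =>
    graphEvent_unique hV hV' lab lab' hl hl' p.1 _ p.2 rfl
  obtain rfl : V = V' := Finset.ext fun p => (h p).1
  congr 1
  exact Subtype.ext (funext fun p => (h p.1).2 p.2 p.2)

/-- The number of labellings of a shape. -/
theorem le_card_labelling {n m : ℕ} {v : Fin m → Fin n} (hv : Function.Injective v)
    (V : Finset (Fin m × List ℕ)) :
    (n - m).descFactorial (nonroots V).card ≤ Nat.card (Labelling v V) := by
  classical
  have hm : Fintype.card {x : Fin n // x ∉ Set.range v} = n - m := by
    rw [Fintype.card_subtype_compl, Fintype.card_fin]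
    congr 1
    exact (Fintype.card_congr (Equiv.ofInjective v hv)).symm.trans (Fintype.card_fin m)
  have hc := Fintype.card_embedding_eq (α := {w // w ∈ nonroots V})
    (β := {x : Fin n // x ∉ Set.range v})
  rw [hm, Fintype.card_coe] at hc
  rw [← hc, ← Nat.card_eq_fintype_card]
  -- Injections of the non-roots into the `n - m` vertices outside the range of `v` extend to
  -- labellings by `v` on the roots.
  let F : ({w // w ∈ nonroots V} ↪ {x : Fin n // x ∉ Set.range v}) → {w // w ∈ V} → Fin n :=
    fun ψ w => if h : w.1.2 = [] then v w.1.1 else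
      ψ ⟨w.1, Finset.mem_filter.2 ⟨w.2, h⟩⟩
  have hF : ∀ ψ, Function.Injective (F ψ) ∧ ∀ i h, F ψ ⟨(i, []), h⟩ = v i := by
    intro ψ
    refine ⟨fun w w' h => ?_, fun i h => by simp [F]⟩
    by_cases h1 : w.1.2 = [] <;> by_cases h2 : w'.1.2 = []
    · simp only [F, h1, h2, dif_pos] at h
      exact Subtype.ext (Prod.ext (hv h) (h1.trans h2.symm))
    · simp only [F, h1, h2, dif_pos, dif_neg, not_false_eq_true] at h
      exact absurd ⟨_, h⟩ (ψ _).2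
    · simp only [F, h1, h2, dif_pos, dif_neg, not_false_eq_true] at h
      exact absurd ⟨_, h.symm⟩ (ψ _).2
    · simp only [F, h1, h2, dif_neg, not_false_eq_true] at h
      have := ψ.injective (Subtype.ext h)
      exact Subtype.ext (congrArg Subtype.val this :)
  refine Nat.card_le_card_of_injective (fun ψ => (⟨F ψ, hF ψ⟩ : Labelling v V)) fun ψ ψ' h => ?_
  have h' : F ψ = F ψ' := congrArg Subtype.val h
  ext w
  have := congrFun h' (toVertex w)
  have hw : w.1.2 ≠ [] := (Finset.mem_filter.1 w.2).2
  simp only [F, toVertex, hw, dif_neg, not_false_eq_true] at this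
  exact congrArg Fin.val this

/-! ### Comparison of the laws of the lengths -/

/-- A measure is dominated by a multiple of a product measure if it is so on boxes. -/
theorem le_of_box_le {ι : Type} [Fintype ι] {ρ M : Measure (ι → ℝ)} {ν : ι → Measure ℝ}
    [∀ i, SigmaFinite (ν i)] {K : ℝ≥0∞} (h0 : K ≠ 0) (htop : K ≠ ∞)
    (hM : ∀ s : ι → Set ℝ, (∀ i, MeasurableSet (s i)) →
      M (Set.univ.pi s) = K * ∏ i, ν i (s i))
    (hρ : ∀ s : ι → Set ℝ, (∀ i, MeasurableSet (s i)) →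
      ρ (Set.univ.pi s) ≤ M (Set.univ.pi s)) : ρ ≤ M := by
  have hMpi : Measure.pi ν = K⁻¹ • M := by
    refine Measure.pi_eq fun s hs => ?_
    rw [Measure.smul_apply, smul_eq_mul, hM s hs, ← mul_assoc, ENNReal.inv_mul_cancel h0 htop,
      one_mul]
  -- `OuterMeasure.pi` is the largest outer measure bounded on boxes by the product of the sides.
  -- Its criterion involves arbitrary boxes, so the sides are replaced by measurable hulls of equal
  -- measure.
  have hle : (K⁻¹ • ρ).toOuterMeasure ≤ OuterMeasure.pi fun i => (ν i).toOuterMeasure := by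
    refine OuterMeasure.le_pi.2 fun s _ => ?_
    have hs : ∀ i, MeasurableSet (toMeasurable (ν i) (s i)) := fun i => measurableSet_toMeasurable _ _
    calc (K⁻¹ • ρ) (Set.univ.pi s) ≤ (K⁻¹ • ρ) (Set.univ.pi fun i => toMeasurable (ν i) (s i)) :=
          measure_mono (Set.pi_mono fun i _ => subset_toMeasurable _ _)
      _ ≤ (K⁻¹ • M) (Set.univ.pi fun i => toMeasurable (ν i) (s i)) := by
          simp only [Measure.smul_apply, smul_eq_mul]
          exact mul_le_mul' le_rfl (hρ _ hs)
      _ = ∏ i, ν i (s i) := by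
          rw [← hMpi, Measure.pi_pi]
          simp only [measure_toMeasurable]
  refine Measure.le_iff.2 fun s hs => ?_
  have h1 : (K⁻¹ • ρ) s ≤ (K⁻¹ • M) s := by
    rw [← hMpi, Measure.pi, toMeasure_apply _ _ hs]
    exact hle s
  simp only [Measure.smul_apply, smul_eq_mul] at h1
  calc ρ s = K * (K⁻¹ * ρ s) := by rw [← mul_assoc, ENNReal.mul_inv_cancel h0 htop, one_mul]
    _ ≤ K * (K⁻¹ * M s) := by gcongr
    _ = M s := by rw [← mul_assoc, ENNReal.mul_inv_cancel h0 htop, one_mul]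

theorem rpow_one_div_le_iff {θ d x : ℝ} (hθ : 0 < θ) (hd : 1 ≤ d) (hx : 0 < x) :
    x ^ (1 / d) ≤ θ ↔ x ≤ θ ^ d := by
  rw [one_div]
  exact Real.rpow_inv_le_iff_of_pos hx.le hθ.le (by linarith)

/-! ### Upper bounds in the tree -/

/-- The law of the lengths of the edges from a vertex of the `d`-PWIT to its children. -/
noncomputable def vertexLaw (d : ℝ) : Measure (ℕ → ℝ) :=
  poissonPoints.map fun x i => x i ^ (1 / d)

theorem measurable_rpow_points (d : ℝ) : Measurable fun (x : ℕ → ℝ) (i : ℕ) => x i ^ (1 / d) := by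
  fun_prop

instance (d : ℝ) : IsProbabilityMeasure (vertexLaw d) :=
  Measure.isProbabilityMeasure_map (measurable_rpow_points d).aemeasurable

theorem pwitLaw_eq (d : ℝ) : pwitLaw d = Measure.infinitePi fun _ : List ℕ => vertexLaw d :=
  Measure.infinitePi_map_pi (fun _ : List ℕ => poissonPoints) fun _ => measurable_rpow_points d

instance (d : ℝ) : IsProbabilityMeasure (pwitLaw d) := by
  rw [pwitLaw_eq]; infer_instance

theorem ae_vertexLaw {d : ℝ} (hd : 1 ≤ d) : ∀ᵐ x ∂vertexLaw d, 0 < x 0 ∧ StrictMono x := by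
  have hms : MeasurableSet {x : ℕ → ℝ | 0 < x 0 ∧ StrictMono x} :=
    (measurable_pi_apply 0 measurableSet_Ioi).inter measurableSet_strictMono
  refine (ae_map_iff (measurable_rpow_points d).aemeasurable hms).2 ?_
  filter_upwards [ae_poissonPoints] with x hx
  refine ⟨Real.rpow_pos_of_pos hx.1 _, fun i j hij => ?_⟩
  have h0 : 0 < x i := hx.1.trans_le (hx.2.monotone (Nat.zero_le i))
  exact Real.rpow_lt_rpow h0.le (hx.2 hij) (by positivity)

theorem vertexLaw_le {θ d : ℝ} (hθ : 0 < θ) (hd : 1 ≤ d) (a : ℕ) :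
    vertexLaw d {x | x a ≤ θ} = poissonPoints {x | x a ≤ θ ^ d} := by
  rw [vertexLaw, Measure.map_apply (measurable_rpow_points d)
    (measurableSet_le (by fun_prop) (by fun_prop))]
  apply measure_congr
  filter_upwards [ae_poissonPoints] with x hx
  have h0 : 0 < x a := hx.1.trans_le (hx.2.monotone (Nat.zero_le a))
  exact propext (rpow_one_div_le_iff hθ hd h0)

/-- In terms of `d`-th powers, the event says that exactly the first `c` Poisson points are at most
`θ ^ d`, so `poissonPoints_box_le` applies almost surely. -/
theorem vertexLaw_box_le {θ d : ℝ} (hθ : 0 < θ) (hd : 1 ≤ d) (c : ℕ) (s : ℕ → Set ℝ)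
    (hs : ∀ i, MeasurableSet (s i)) :
    vertexLaw d {x | (∀ a, x a ≤ θ ↔ a < c) ∧ ∀ a < c, x a ∈ s a} ≤
      ENNReal.ofReal (Real.exp (-θ ^ d)) * ∏ a ∈ Finset.range c,
        volume ((fun y : ℝ => y ^ (1 / d)) ⁻¹' s a ∩ Set.Ioc 0 (θ ^ d)) := by
  have hq : Measurable fun y : ℝ => y ^ (1 / d) := by fun_prop
  have hms : MeasurableSet {x : ℕ → ℝ | (∀ a, x a ≤ θ ↔ a < c) ∧ ∀ a < c, x a ∈ s a} := by
    refine MeasurableSet.inter (measurableSet_forall fun a => ?_)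
      (measurableSet_forall fun a => measurableSet_forall fun _ => measurable_pi_apply a (hs a))
    have h : MeasurableSet {x : ℕ → ℝ | x a ≤ θ} := measurableSet_le (by fun_prop) (by fun_prop)
    by_cases hm : a < c
    · simpa [hm] using h
    · have : {x : ℕ → ℝ | x a ≤ θ ↔ a < c} = {x | x a ≤ θ}ᶜ := by
        ext t
        simp [hm]
      exact this ▸ h.compl
  rw [vertexLaw, Measure.map_apply (measurable_rpow_points d) hms]
  refine le_trans (measure_mono_ae ?_) (poissonPoints_box_le c (θ ^ d)
    (fun a => (fun y : ℝ => y ^ (1 / d)) ⁻¹' s a ∩ Set.Ioc 0 (θ ^ d))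
    fun a => (hq (hs a)).inter measurableSet_Ioc)
  filter_upwards [ae_poissonPoints] with x hx
  rintro ⟨h1, h2⟩
  have h0 : ∀ a, 0 < x a := fun a => hx.1.trans_le (hx.2.monotone (Nat.zero_le a))
  have hle : ∀ a, x a ≤ θ ^ d ↔ a < c := fun a =>
    (rpow_one_div_le_iff hθ hd (h0 a)).symm.trans (h1 a)
  exact ⟨fun a ha => ⟨(hle a).2 ha, h2 a ha, h0 a, (hle a).2 ha⟩,
    not_le.1 fun h => lt_irrefl _ ((hle c).1 h)⟩

theorem exists_children {k m : ℕ} {V : Finset (Fin m × List ℕ)} (hV : IsShape k V) (i : Fin m)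
    (u : List ℕ) : ∃ c, ∀ a, (i, a :: u) ∈ V ↔ a < c := by
  classical
  have hex : ∃ a, (i, a :: u) ∉ V := by
    by_contra! hcon
    refine Set.infinite_of_injective_forall_mem (f := fun a : ℕ => (i, a :: u)) ?_ hcon
      V.finite_toSet
    intro a b h
    simpa using h
  refine ⟨Nat.find hex, fun a => ⟨fun h => ?_, fun h => not_not.1 (Nat.find_min hex h)⟩⟩
  by_contra hcon
  exact Nat.find_spec hex (hV.lower (not_lt.1 hcon) h)

/-- The vertices of a shape of depth less than `k`. -/
def innerVertices (k : ℕ) {m : ℕ} (V : Finset (Fin m × List ℕ)) : Finset (Fin m × List ℕ) :=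
  V.filter fun w => w.2.length < k

/-- Distinct inner vertices have independent families of child edges. Each contributes one
exponential factor, and each non-root contributes one volume, counted at its parent. -/
theorem pi_pwitLaw_box_le {k m : ℕ} {θ d : ℝ} (hθ : 0 < θ) (hd : 1 ≤ d)
    {V : Finset (Fin m × List ℕ)} (hV : IsShape k V) (S : Fin m × List ℕ → Set ℝ)
    (hS : ∀ w, MeasurableSet (S w)) :
    (Measure.pi fun _ : Fin m => pwitLaw d) (treeEvent k θ V ∩
        {t | ∀ w ∈ nonroots V, parentEdge (t w.1) w.2 ∈ S w}) ≤
      ENNReal.ofReal (Real.exp (-θ ^ d)) ^ (innerVertices k V).card * ∏ w ∈ nonroots V,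
        volume ((fun y : ℝ => y ^ (1 / d)) ⁻¹' S w ∩ Set.Ioc 0 (θ ^ d)) := by
  classical
  set E := ENNReal.ofReal (Real.exp (-θ ^ d))
  set g : Fin m × List ℕ → ℝ≥0∞ := fun w =>
    volume ((fun y : ℝ => y ^ (1 / d)) ⁻¹' S w ∩ Set.Ioc 0 (θ ^ d))
  choose c hc using exists_children hV
  let Ex : Fin m → Finset (List ℕ) := fun i => ((innerVertices k V).filter (·.1 = i)).image Prod.snd
  have hEx : ∀ i u, u ∈ Ex i ↔ (i, u) ∈ innerVertices k V := by
    intro i u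
    simp only [Ex, Finset.mem_image, Finset.mem_filter]
    constructor
    · rintro ⟨⟨j, w⟩, ⟨h, rfl⟩, rfl⟩; exact h
    · intro h; exact ⟨_, ⟨h, rfl⟩, rfl⟩
  -- Measurable hulls allow the product formula to be applied without changing the measures of the
  -- sets.
  let C : Fin m → List ℕ → Set (ℕ → ℝ) := fun i u =>
    toMeasurable (vertexLaw d) {x | (∀ a, x a ≤ θ ↔ a < c i u) ∧ ∀ a < c i u, x a ∈ S (i, a :: u)}
  have hsub : treeEvent k θ V ∩ {t | ∀ w ∈ nonroots V, parentEdge (t w.1) w.2 ∈ S w} ⊆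
      Set.univ.pi fun i => Set.pi (Ex i) (C i) := by
    rintro t ⟨ht, ht'⟩ i - u hu
    obtain ⟨hu, hlt⟩ := Finset.mem_filter.1 ((hEx i u).1 hu)
    refine subset_toMeasurable _ _ ⟨fun a => ((ht i u hu hlt).2 a).trans (hc i u a), fun a ha => ?_⟩
    exact ht' _ (cons_mem_nonroots.2 ((hc i u a).2 ha))
  refine (measure_mono hsub).trans ?_
  rw [Measure.pi_pi]
  simp only [pwitLaw_eq]
  have hprod : ∀ i, (Measure.infinitePi fun _ : List ℕ => vertexLaw d) (Set.pi (Ex i) (C i)) =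
      ∏ u ∈ Ex i, vertexLaw d (C i u) := fun i =>
    Measure.infinitePi_pi _ fun u _ => measurableSet_toMeasurable _ _
  simp only [hprod]
  rw [← Finset.prod_finset_product (innerVertices k V) Finset.univ Ex
    (fun p => by simp [hEx]) (f := fun p => vertexLaw d (C p.1 p.2))]
  have hone : ∀ p ∈ innerVertices k V, vertexLaw d (C p.1 p.2) ≤
      E * ∏ w ∈ nonroots V with (w.1, w.2.tail) = p, g w := by
    rintro ⟨i, u⟩ -
    simp only [C, measure_toMeasurable]
    refine (vertexLaw_box_le hθ hd (c i u) (fun a => S (i, a :: u)) fun a => hS _).trans ?_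
    gcongr
    apply le_of_eq
    refine Finset.prod_bij (fun a _ => (i, a :: u)) ?_ ?_ ?_ ?_
    · intro a ha
      simp only [Finset.mem_filter, cons_mem_nonroots, hc]
      exact ⟨Finset.mem_range.1 ha, rfl⟩
    · intro a _ b _ h
      simpa using h
    · rintro ⟨j, w⟩ hw
      obtain ⟨h1, h2⟩ := Finset.mem_filter.1 hw
      obtain rfl : j = i := congrArg Prod.fst h2
      have h2 : w.tail = u := congrArg Prod.snd h2
      cases w with
      | nil => simp [nonroots] at h1
      | cons a w =>
        obtain rfl : w = u := h2
        exact ⟨a, Finset.mem_range.2 ((hc _ _ _).1 (cons_mem_nonroots.1 h1)), rfl⟩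
    · intro a _
      rfl
  refine (Finset.prod_le_prod' hone).trans ?_
  rw [Finset.prod_mul_distrib, Finset.prod_const, Finset.prod_fiberwise_of_maps_to]
  rintro ⟨i, u⟩ h
  cases u with
  | nil => simp [nonroots] at h
  | cons a u =>
    rw [cons_mem_nonroots] at h
    exact Finset.mem_filter.2 ⟨hV.parent_mem h, hV.length_le h⟩

/-! ### Lower bounds in the mean field model and the comparison -/

/-- The law of the length of an edge in the mean field model. -/
noncomputable def edgeLaw (n : ℕ) (d : ℝ) : Measure ℝ :=
  (expMeasure 1).map fun x => ((n : ℝ) * x) ^ (1 / d)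

theorem measurable_edge_length (n : ℕ) (d : ℝ) :
    Measurable fun x : ℝ => ((n : ℝ) * x) ^ (1 / d) := by
  fun_prop

instance (n : ℕ) (d : ℝ) : IsProbabilityMeasure (edgeLaw n d) :=
  Measure.isProbabilityMeasure_map (measurable_edge_length n d).aemeasurable

theorem meanFieldLaw_eq (n : ℕ) (d : ℝ) :
    meanFieldLaw n d = Measure.pi fun _ : Edges n => edgeLaw n d :=
  (Measure.pi_map_pi fun _ => (measurable_edge_length n d).aemeasurable)

instance (n : ℕ) (d : ℝ) : IsProbabilityMeasure (meanFieldLaw n d) := by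
  rw [meanFieldLaw_eq]; infer_instance

theorem le_edgeLaw_Ioi {n : ℕ} (hn : 0 < n) {θ d : ℝ} (hθ : 0 < θ) (hd : 1 ≤ d) :
    ENNReal.ofReal (Real.exp (-(θ ^ d / n))) ≤ edgeLaw n d (Set.Ioi θ) := by
  have hn' : (0 : ℝ) < n := by exact_mod_cast hn
  have hl : 0 < θ ^ d := Real.rpow_pos_of_pos hθ d
  rw [edgeLaw, Measure.map_apply (measurable_edge_length n d) measurableSet_Ioi,
    ← expMeasure_Ioi (by positivity)]
  refine measure_mono fun x hx => ?_
  have hx' : θ ^ d < n * x := by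
    have := (div_lt_iff₀ hn').1 (Set.mem_Ioi.1 hx)
    linarith
  by_contra hcon
  have := (rpow_one_div_le_iff hθ hd (hl.trans hx')).1 (not_lt.1 hcon)
  linarith

/-- On `(0, θ ^ d]`, the density `n⁻¹ * exp (-y / n)` of `n * X` is at least its value at `θ ^ d`.
-/
theorem le_edgeLaw_inter {n : ℕ} (hn : 0 < n) {θ d : ℝ} (hθ : 0 < θ) (hd : 1 ≤ d) {s : Set ℝ}
    (hs : MeasurableSet s) :
    (n : ℝ≥0∞)⁻¹ * ENNReal.ofReal (Real.exp (-(θ ^ d / n))) *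
        volume ((fun y : ℝ => y ^ (1 / d)) ⁻¹' s ∩ Set.Ioc 0 (θ ^ d)) ≤
      edgeLaw n d (s ∩ Set.Ioc 0 θ) := by
  have hn' : (0 : ℝ) < n := by exact_mod_cast hn
  have hq : Measurable fun y : ℝ => y ^ (1 / d) := by fun_prop
  set A := (fun y : ℝ => y ^ (1 / d)) ⁻¹' s ∩ Set.Ioc 0 (θ ^ d)
  have hA : MeasurableSet A := (hq hs).inter measurableSet_Ioc
  have hA' : MeasurableSet ((fun x : ℝ => (n : ℝ) * x) ⁻¹' A) := (measurable_const_mul _) hA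
  rw [edgeLaw, Measure.map_apply (measurable_edge_length n d) (hs.inter measurableSet_Ioc)]
  have hsub : (fun x : ℝ => (n : ℝ) * x) ⁻¹' A ⊆
      (fun x : ℝ => ((n : ℝ) * x) ^ (1 / d)) ⁻¹' (s ∩ Set.Ioc 0 θ) := by
    rintro x ⟨h1, h2, h3⟩
    exact ⟨h1, Real.rpow_pos_of_pos h2 _, (rpow_one_div_le_iff hθ hd h2).2 h3⟩
  refine le_trans ?_ (measure_mono hsub)
  rw [expMeasure_apply hA']
  have hvol : volume ((fun x : ℝ => (n : ℝ) * x) ⁻¹' A) = (n : ℝ≥0∞)⁻¹ * volume A := by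
    rw [Real.volume_preimage_mul_left hn'.ne', abs_of_pos (by positivity),
      ENNReal.ofReal_inv_of_pos hn', ENNReal.ofReal_natCast]
  calc _ = ∫⁻ _ in (fun x : ℝ => (n : ℝ) * x) ⁻¹' A, ENNReal.ofReal (Real.exp (-(θ ^ d / n))) := by
        rw [setLIntegral_const, hvol]
        ring
    _ ≤ _ := by
        refine setLIntegral_mono' hA' ?_
        rintro x ⟨-, h2, h3⟩
        have hx : 0 ≤ x := ((mul_pos_iff_of_pos_left hn').1 h2).le
        rw [exponentialPDF_of_nonneg hx, one_mul, one_mul]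
        gcongr
        rw [le_div_iff₀ hn']
        linarith

section Comparison

variable {k n m : ℕ} {v : Fin m → Fin n} {V : Finset (Fin m × List ℕ)}

theorem edge_mem_touching (hV : IsShape k V) (lab : Labelling v V) (w : {w // w ∈ nonroots V}) :
    edge hV lab w ∈ touching k lab := by
  refine ⟨parent hV w, ?_, by simp [edge]⟩
  obtain ⟨-, a, ha⟩ := isChild_parent hV w
  have h : (toVertex w).1.2.length ≤ k := hV.length_le (toVertex w).2
  rw [ha] at h
  exact h

-- A touching edge is determined by an inner vertex of the shape at one end and one of the `n`
-- vertices at the other.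
open Classical in
theorem card_touching_le (lab : Labelling v V) :
    (Finset.univ.filter (· ∈ touching k lab)).card ≤ n * (innerVertices k V).card := by
  have h : ∀ e : {e // e ∈ Finset.univ.filter (· ∈ touching k lab)},
      ∃ q : {w // w ∈ innerVertices k V} × Fin n,
        e.1.1 = s(lab.1 ⟨q.1.1, (Finset.mem_filter.1 q.1.2).1⟩, q.2) := by
    rintro ⟨e, he⟩
    obtain ⟨p, hp, hmem⟩ := (Finset.mem_filter.1 he).2
    obtain ⟨y, hy⟩ := Sym2.mem_iff_exists.1 hmem
    exact ⟨⟨⟨p.1, Finset.mem_filter.2 ⟨p.2, hp⟩⟩, y⟩, hy⟩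
  choose q hq using h
  have hinj : Function.Injective q := by
    intro e e' he
    have h1 := hq e
    rw [he, ← hq e'] at h1
    exact Subtype.ext (Subtype.ext h1)
  have := Fintype.card_le_of_injective q hinj
  rw [Fintype.card_prod, Fintype.card_fin, Fintype.card_coe, Fintype.card_coe] at this
  linarith

/-- The law of the tree, restricted to a shape and divided by the number of labellings that are not
necessarily injective, is dominated by the law of the mean field model on the labelled shape, when it
comes to the lengths of the edges of the shape. -/
theorem map_treeLengths_le (hn : 0 < n) {θ d : ℝ} (hθ : 0 < θ) (hd : 1 ≤ d) (hV : IsShape k V)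
    (lab : Labelling v V) :
    (((n : ℝ≥0∞)⁻¹ ^ (nonroots V).card) •
        (Measure.pi fun _ : Fin m => pwitLaw d).restrict (treeEvent k θ V)).map (treeLengths V) ≤
      ((meanFieldLaw n d).restrict (graphEvent θ hV lab)).map (graphLengths hV lab) := by
  classical
  set μ := Measure.pi fun _ : Fin m => pwitLaw d
  set ρ := (((n : ℝ≥0∞)⁻¹ ^ (nonroots V).card) • μ.restrict (treeEvent k θ V)).map (treeLengths V)
    with hρ
  set M := ((meanFieldLaw n d).restrict (boxEvent θ hV lab)).map (graphLengths hV lab) with hM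
  have hgm := measurable_graphLengths hV lab
  have hfm := measurable_treeLengths V
  have hρs : ∀ s, MeasurableSet s → ρ s = (n : ℝ≥0∞)⁻¹ ^ (nonroots V).card *
      μ (treeLengths V ⁻¹' s ∩ treeEvent k θ V) := by
    intro s hs
    rw [hρ, Measure.map_apply hfm hs, Measure.smul_apply, Measure.restrict_apply (hfm hs),
      smul_eq_mul]
  have hMs : ∀ s, MeasurableSet s → M s =
      meanFieldLaw n d (graphLengths hV lab ⁻¹' s ∩ boxEvent θ hV lab) := by
    intro s hs
    rw [hM, Measure.map_apply hgm hs, Measure.restrict_apply (hgm hs)]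
  -- On `treeEvent` the lengths of siblings increase automatically, so the order constraint may be
  -- dropped for the comparison. What remains on the graph side is a product measure.
  suffices hle : ρ ≤ M by
    refine Measure.le_iff.2 fun s hs => ?_
    have hO := measurableSet_ordered V
    have e1 : ρ s = ρ (s ∩ ordered V) := by
      rw [hρs _ hs, hρs _ (hs.inter hO)]
      congr 2
      ext t
      simp only [Set.mem_inter_iff, Set.mem_preimage]
      refine ⟨fun ⟨h1, h2⟩ => ⟨⟨h1, ?_⟩, h2⟩, fun ⟨⟨h1, _⟩, h2⟩ => ⟨h1, h2⟩⟩
      rintro ⟨⟨i, u⟩, hu⟩ ⟨⟨j, w⟩, hw⟩ (rfl : i = j) htail hhead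
      cases u with
      | nil => simp [nonroots] at hu
      | cons a u =>
        cases w with
        | nil => simp [nonroots] at hw
        | cons b w =>
          obtain rfl : u = w := htail
          rw [cons_mem_nonroots] at hu
          exact (h2 i u (hV.parent_mem hu) (hV.length_le hu)).1.2 hhead
    rw [e1, Measure.map_apply hgm hs, Measure.restrict_apply (hgm hs)]
    refine (hle _).trans ?_
    rw [hMs _ (hs.inter hO)]
    refine measure_mono ?_
    rintro l ⟨⟨h1, h2⟩, h3⟩
    exact ⟨h1, h3, h2⟩
  set R : Finset (Edges n) := Finset.univ.image (edge hV lab) with hR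
  have hRmem : ∀ e, e ∈ R ↔ e ∈ Set.range (edge hV lab) := by simp [hR]
  -- `boxEvent` constrains the independent edges separately: short on the shape, long on the other
  -- touching edges, free elsewhere. `K` below is the probability of the constraints off the shape.
  let b : Edges n → Set ℝ := fun e =>
    if e ∈ R then Set.Ioc 0 θ else if e ∈ touching k lab then Set.Ioi θ else Set.univ
  have hbox : boxEvent θ hV lab = Set.univ.pi b := by
    ext l
    constructor
    · rintro ⟨h1, h2⟩ e -
      simp only [b]
      split_ifs with he he'
      · obtain ⟨w, rfl⟩ := (hRmem e).1 he
        exact h1 w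
      · exact h2 e he' ((hRmem e).not.1 he)
      · trivial
    · intro h
      refine ⟨fun w => ?_, fun e he he' => ?_⟩
      · have := h (edge hV lab w) trivial
        simpa only [b, if_pos ((hRmem _).2 ⟨w, rfl⟩)] using this
      · have := h e trivial
        simp only [b, if_neg ((hRmem _).not.2 he'), if_pos he] at this
        exact this
  set r := ENNReal.ofReal (Real.exp (-(θ ^ d / n))) with hr
  set K := ∏ e ∈ Rᶜ, edgeLaw n d (b e) with hK
  have hKr : r ^ (Rᶜ.filter (· ∈ touching k lab)).card ≤ K := by
    have h1 : ∀ e ∈ Rᶜ, (if e ∈ touching k lab then r else 1) ≤ edgeLaw n d (b e) := by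
      intro e he
      simp only [b, if_neg (Finset.mem_compl.1 he)]
      split_ifs
      · exact le_edgeLaw_Ioi hn hθ hd
      · rw [measure_univ]
    refine le_trans (le_of_eq ?_) (Finset.prod_le_prod' h1)
    rw [Finset.prod_ite]
    simp
  have hr0 : r ≠ 0 := by
    rw [hr, Ne, ENNReal.ofReal_eq_zero, not_le]
    positivity
  have hK0 : K ≠ 0 := fun h => pow_ne_zero _ hr0 (le_antisymm (hKr.trans h.le) zero_le)
  have hKtop : K ≠ ∞ := ENNReal.prod_ne_top fun e _ => measure_ne_top _ _
  have hMbox : ∀ s : {w // w ∈ nonroots V} → Set ℝ, (∀ i, MeasurableSet (s i)) →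
      M (Set.univ.pi s) = K * ∏ w, (edgeLaw n d).restrict (Set.Ioc 0 θ) (s w) := by
    intro s hs
    rw [hMs _ (MeasurableSet.univ_pi hs), hbox]
    have hset : graphLengths hV lab ⁻¹' Set.univ.pi s ∩ Set.univ.pi b =
        Set.univ.pi fun e => {x | ∀ w, edge hV lab w = e → x ∈ s w} ∩ b e := by
      ext l
      simp only [Set.mem_inter_iff, Set.mem_preimage, Set.mem_univ_pi, Set.mem_ofPred_eq]
      constructor
      · rintro ⟨h1, h2⟩ e
        refine ⟨?_, h2 e⟩
        rintro w rfl
        exact h1 w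
      · intro h
        exact ⟨fun w => (h _).1 w rfl, fun e => (h e).2⟩
    rw [hset, meanFieldLaw_eq, Measure.pi_pi, ← Finset.prod_compl_mul_prod R]
    congr 1
    · refine Finset.prod_congr rfl fun e he => ?_
      congr 1
      refine Set.inter_eq_right.2 fun x _ w hw => ?_
      exact absurd ((hRmem e).2 ⟨w, hw⟩) (Finset.mem_compl.1 he)
    · rw [hR, Finset.prod_image (edge_injective hV lab).injOn]
      refine Finset.prod_congr rfl fun w _ => ?_
      rw [Measure.restrict_apply (hs w)]
      congr 1
      have hb : b (edge hV lab w) = Set.Ioc 0 θ := if_pos ((hRmem _).2 ⟨w, rfl⟩)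
      rw [hb]
      congr 1
      ext x
      constructor
      · exact fun h => h w rfl
      · intro h w' hw'
        rwa [edge_injective hV lab hw']
  refine le_of_box_le hK0 hKtop hMbox fun s hs => ?_
  rw [hMbox s hs, hρs _ (MeasurableSet.univ_pi hs)]
  let S : Fin m × List ℕ → Set ℝ := fun w => if h : w ∈ nonroots V then s ⟨w, h⟩ else Set.univ
  have hS : ∀ w, MeasurableSet (S w) := by
    intro w
    simp only [S]
    split_ifs
    · exact hs _
    · exact .univ
  have hSs : ∀ w : {w // w ∈ nonroots V}, S w.1 = s w := fun w => dif_pos w.2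
  have hset : treeLengths V ⁻¹' Set.univ.pi s ∩ treeEvent k θ V ⊆ treeEvent k θ V ∩
        {t | ∀ w ∈ nonroots V, parentEdge (t w.1) w.2 ∈ S w} := by
    rintro t ⟨h1, h2⟩
    refine ⟨h2, fun w hw => ?_⟩
    have := h1 ⟨w, hw⟩ trivial
    rw [← hSs] at this
    exact this
  set G : Fin m × List ℕ → ℝ≥0∞ := fun w =>
    volume ((fun y : ℝ => y ^ (1 / d)) ⁻¹' S w ∩ Set.Ioc 0 (θ ^ d))
  have hbound := (measure_mono hset).trans (pi_pwitLaw_box_le hθ hd hV S hS)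
  set E := ENNReal.ofReal (Real.exp (-θ ^ d)) with hE
  have hn' : (0 : ℝ) < n := by exact_mod_cast hn
  have hrn : r ^ n = E := by
    rw [hr, ← ENNReal.ofReal_pow (by positivity), ← Real.exp_nat_mul, hE]
    congr 2
    field_simp
  have hr1 : r ≤ 1 := by
    rw [hr, ← ENNReal.ofReal_one]
    refine ENNReal.ofReal_le_ofReal (Real.exp_le_one_iff.2 ?_)
    have := Real.rpow_pos_of_pos hθ d
    rw [neg_nonpos]
    positivity
  -- There is a factor `r` for each touching edge. Since `r ^ n = E` and `r ≤ 1`, having at most `n`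
  -- such edges per inner vertex gives the bound `E ^ (innerVertices k V).card`.
  have hcard : (nonroots V).card + (Rᶜ.filter (· ∈ touching k lab)).card ≤
      n * (innerVertices k V).card := by
    refine le_trans (le_of_eq ?_) (card_touching_le lab)
    have hRcard : R.card = (nonroots V).card := by
      rw [hR, Finset.card_image_of_injective _ (edge_injective hV lab), Finset.card_univ,
        Fintype.card_coe]
    rw [← hRcard, ← Finset.card_union_of_disjoint]
    · congr 1
      ext e
      simp only [Finset.mem_union, Finset.mem_filter, Finset.mem_compl, Finset.mem_univ, true_and]
      constructor
      · rintro (h | h)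
        · obtain ⟨w, rfl⟩ := (hRmem e).1 h
          exact edge_mem_touching hV lab w
        · exact h.2
      · intro h
        by_cases he : e ∈ R
        · exact .inl he
        · exact .inr ⟨he, h⟩
    · rw [Finset.disjoint_left]
      intro e he he'
      exact Finset.mem_compl.1 (Finset.mem_filter.1 he').1 he
  calc _ ≤ (n : ℝ≥0∞)⁻¹ ^ (nonroots V).card *
        (E ^ (innerVertices k V).card * ∏ w ∈ nonroots V, G w) := by gcongr
    _ ≤ (n : ℝ≥0∞)⁻¹ ^ (nonroots V).card *
        (r ^ ((nonroots V).card + (Rᶜ.filter (· ∈ touching k lab)).card) *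
          ∏ w ∈ nonroots V, G w) := by
        rw [← hrn, ← pow_mul]
        exact mul_le_mul' le_rfl (mul_le_mul' (pow_le_pow_right_of_le_one' hr1 hcard) le_rfl)
    _ = r ^ (Rᶜ.filter (· ∈ touching k lab)).card *
        ∏ w ∈ nonroots V, ((n : ℝ≥0∞)⁻¹ * r * G w) := by
        rw [Finset.prod_mul_distrib, Finset.prod_const, mul_pow, pow_add]
        ring
    _ ≤ K * ∏ w ∈ nonroots V, edgeLaw n d (S w ∩ Set.Ioc 0 θ) :=
        mul_le_mul' hKr (Finset.prod_le_prod' fun w _ => le_edgeLaw_inter hn hθ hd (hS w))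
    _ = _ := by
        rw [← Finset.prod_coe_sort]
        congr 1
        refine Finset.prod_congr rfl fun w _ => ?_
        rw [Measure.restrict_apply (hs w), hSs]

end Comparison

/-! ### The size of the neighborhoods in the trees -/

/-- All edges on the path from the root to a vertex have length at most `θ`. -/
def Alive (θ : ℝ) (t : List ℕ → ℕ → ℝ) : List ℕ → Prop
  | [] => True
  | a :: u => t u a ≤ θ ∧ Alive θ t u

theorem measurableSet_alive (θ : ℝ) (u : List ℕ) :
    MeasurableSet {t : List ℕ → ℕ → ℝ | Alive θ t u} := by
  induction u with
  | nil => simp [Alive]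
  | cons a u ih =>
    exact ((by fun_prop : Measurable fun t : List ℕ → ℕ → ℝ => t u a) measurableSet_Iic).inter ih

/-- The edges on the path to `u` start at distinct vertices, so their lengths are independent. In
the induction, the bound on lengths shows that `u` is a new coordinate. -/
theorem pwitLaw_alive (θ d : ℝ) (u : List ℕ) :
    pwitLaw d {t | Alive θ t u} = (u.map fun a => vertexLaw d {x | x a ≤ θ}).prod := by
  classical
  have key : ∃ (s : Finset (List ℕ)) (C : List ℕ → Set (ℕ → ℝ)), (∀ w, MeasurableSet (C w)) ∧
      {t | Alive θ t u} = Set.pi s C ∧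
      ∏ w ∈ s, vertexLaw d (C w) = (u.map fun a => vertexLaw d {x | x a ≤ θ}).prod ∧
      ∀ w ∈ s, w.length < u.length := by
    induction u with
    | nil => exact ⟨∅, fun _ => Set.univ, fun _ => .univ, by simp [Alive], by simp, by simp⟩
    | cons a u ih =>
      obtain ⟨s, C, hC, h1, h2, h3⟩ := ih
      have hu : u ∉ s := fun h => lt_irrefl _ (h3 u h)
      have hne : ∀ w ∈ s, w ≠ u := fun w hw h => hu (h ▸ hw)
      refine ⟨insert u s, Function.update C u {x | x a ≤ θ}, fun w => ?_, ?_, ?_, ?_⟩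
      · by_cases hw : w = u
        · subst hw
          rw [Function.update_self]
          exact measurableSet_le (by fun_prop) (by fun_prop)
        · rw [Function.update_of_ne hw]
          exact hC w
      · ext t
        have h1t : Alive θ t u ↔ ∀ w ∈ s, t w ∈ C w := by
          have : t ∈ {t | Alive θ t u} ↔ t ∈ Set.pi s C := by rw [h1]
          exact this
        simp only [Set.mem_ofPred_eq, Alive, h1t, Set.mem_pi, Finset.coe_insert,
          Set.forall_mem_insert, Function.update_self, Finset.mem_coe]
        refine and_congr Iff.rfl (forall₂_congr fun w hw => ?_)
        rw [Function.update_of_ne (hne w hw)]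
      · rw [Finset.prod_insert hu, Function.update_self, List.map_cons, List.prod_cons, ← h2]
        congr 1
        exact Finset.prod_congr rfl fun w hw => by rw [Function.update_of_ne (hne w hw)]
      · intro w hw
        rcases Finset.mem_insert.1 hw with rfl | hw
        · simp
        · have := h3 w hw
          rw [List.length_cons]
          omega
  obtain ⟨s, C, hC, h1, h2, -⟩ := key
  rw [h1, pwitLaw_eq, Measure.infinitePi_pi _ fun w _ => hC w, h2]

theorem tsum_list_eq (F : List ℕ → ℝ≥0∞) :
    ∑' u, F u = F [] + ∑' a : ℕ, ∑' u, F (a :: u) := by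
  classical
  rw [ENNReal.tsum_eq_add_tsum_ite []]
  congr 1
  rw [← ENNReal.tsum_prod (f := fun a u => F (a :: u))]
  have hinj : Function.Injective fun p : ℕ × List ℕ => p.1 :: p.2 := by
    rintro ⟨a, u⟩ ⟨b, w⟩ h
    simpa using h
  rw [← hinj.tsum_eq]
  · refine tsum_congr fun p => ?_
    simp
  · intro u hu
    cases u with
    | nil => simp at hu
    | cons a u => exact ⟨(a, u), rfl⟩

/-- A bound for the expected number of vertices of depth at most `k` in a neighborhood. -/
noncomputable def expectedSize (θ d : ℝ) (k : ℕ) : ℝ≥0∞ :=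
  ∑' u : List ℕ, if u.length ≤ k then pwitLaw d {t | Alive θ t u} else 0

theorem expectedSize_zero (θ d : ℝ) : expectedSize θ d 0 = 1 := by
  rw [expectedSize, tsum_list_eq]
  simp [Alive]

/-- The vertex `a :: u` is alive when `u` is and the last edge is short, and these are independent.
Summing the probability of the latter over `a` gives the expected number of Poisson points up to `θ
^ d`. -/
theorem expectedSize_succ_le {θ d : ℝ} (hθ : 0 < θ) (hd : 1 ≤ d) (k : ℕ) :
    expectedSize θ d (k + 1) ≤ 1 + ENNReal.ofReal (θ ^ d) * expectedSize θ d k := by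
  rw [expectedSize, tsum_list_eq]
  simp only [pwitLaw_alive, List.length_nil, Nat.zero_le, if_true, List.map_nil, List.prod_nil,
    List.length_cons, Nat.add_le_add_iff_right, List.map_cons, List.prod_cons]
  gcongr
  have : ∀ a : ℕ, (∑' u : List ℕ, if u.length ≤ k then vertexLaw d {x | x a ≤ θ} *
      (u.map fun a => vertexLaw d {x | x a ≤ θ}).prod else 0) =
      vertexLaw d {x | x a ≤ θ} * expectedSize θ d k := by
    intro a
    rw [expectedSize, ← ENNReal.tsum_mul_left]
    refine tsum_congr fun u => ?_
    rw [pwitLaw_alive]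
    split_ifs <;> simp
  simp only [this]
  rw [ENNReal.tsum_mul_right]
  gcongr
  simp only [vertexLaw_le hθ hd]
  exact tsum_poissonPoints_le _

/-- The added `1` absorbs the constant `m + 1` that the recursion produces at each step. For `m ≥
1`, replacing `B` by `m * B + 1` makes the bound factor. -/
theorem mul_expectedSize_le {θ d : ℝ} (hθ : 0 < θ) (hd : 1 ≤ d) (m k : ℕ) :
    m * expectedSize θ d (k + 1) + 1 ≤ (m * ENNReal.ofReal (θ ^ d) + m + 1) ^ (k + 1) := by
  set L := ENNReal.ofReal (θ ^ d)
  rcases Nat.eq_zero_or_pos m with rfl | hm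
  · simp
  have hm1 : (1 : ℝ≥0∞) ≤ m := by exact_mod_cast hm
  induction k with
  | zero =>
    have h := expectedSize_succ_le hθ hd 0
    rw [expectedSize_zero, mul_one] at h
    calc _ ≤ (m : ℝ≥0∞) * (1 + L) + 1 := by gcongr
      _ = _ := by ring
  | succ k ih =>
    set B := expectedSize θ d (k + 1)
    calc _ ≤ (m : ℝ≥0∞) * (1 + L * B) + 1 := by
          gcongr
          exact expectedSize_succ_le hθ hd (k + 1)
      _ = m * L * (1 * B) + (m + 1) * 1 := by ring
      _ ≤ m * L * (m * B + 1) + (m + 1) * (m * B + 1) := by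
          gcongr
          · exact (mul_le_mul' hm1 le_rfl).trans le_self_add
          · exact le_add_self
      _ = (m * L + m + 1) * (m * B + 1) := by ring
      _ ≤ (m * L + m + 1) * (m * L + m + 1) ^ (k + 1) := by gcongr
      _ = _ := by ring

theorem expectedSize_ne_top {θ d : ℝ} (hθ : 0 < θ) (hd : 1 ≤ d) (k : ℕ) :
    expectedSize θ d k ≠ ∞ := by
  induction k with
  | zero => simp [expectedSize_zero]
  | succ k ih =>
    refine ne_top_of_le_ne_top ?_ (expectedSize_succ_le hθ hd k)
    exact ENNReal.add_ne_top.2 ⟨ENNReal.one_ne_top, ENNReal.mul_ne_top ENNReal.ofReal_ne_top ih⟩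

/-- The set of trees in which a vertex belongs to the neighborhood of a root. -/
def aliveEvent (k : ℕ) (θ : ℝ) {m : ℕ} (w : Fin m × List ℕ) : Set (Fin m → List ℕ → ℕ → ℝ) :=
  {t | w.2.length ≤ k ∧ Alive θ (t w.1) w.2}

theorem tsum_aliveEvent (k : ℕ) (θ d : ℝ) (m : ℕ) :
    ∑' w : Fin m × List ℕ, (Measure.pi fun _ : Fin m => pwitLaw d) (aliveEvent k θ w) =
      m * expectedSize θ d k := by
  have h : ∀ i u, (Measure.pi fun _ : Fin m => pwitLaw d) (aliveEvent k θ (i, u)) =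
      if u.length ≤ k then pwitLaw d {t | Alive θ t u} else 0 := by
    intro i u
    split_ifs with hu
    · rw [← (measurePreserving_eval (fun _ : Fin m => pwitLaw d) i).measure_preimage
        (measurableSet_alive θ u).nullMeasurableSet]
      congr 1
      ext t
      exact and_iff_right hu
    · have : aliveEvent k θ (i, u) = (∅ : Set (Fin m → List ℕ → ℕ → ℝ)) := by
        ext t
        exact iff_of_false (fun h => hu h.1) id
      rw [this, measure_empty]
  rw [ENNReal.tsum_prod (f := fun i u =>
    (Measure.pi fun _ : Fin m => pwitLaw d) (aliveEvent k θ (i, u)))]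
  simp only [h, tsum_fintype]
  rw [Finset.sum_const, Finset.card_univ, Fintype.card_fin, nsmul_eq_mul, expectedSize]

theorem treeEvent_subset_aliveEvent {k m : ℕ} {θ : ℝ} {V : Finset (Fin m × List ℕ)}
    (hV : IsShape k V) {w : Fin m × List ℕ} (hw : w ∈ V) :
    treeEvent k θ V ⊆ aliveEvent k θ w := by
  intro t ht
  obtain ⟨i, u⟩ := w
  refine ⟨hV.length_le hw, ?_⟩
  change Alive θ (t i) u
  induction u with
  | nil => trivial
  | cons a u ih =>
    have hp := hV.parent_mem hw
    exact ⟨((ht i u hp (hV.length_le hw)).2 a).2 hw, ih hp⟩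

/-- The expected number of alive vertices is finite, so almost surely they form a finite set. It is
closed under earlier siblings because the lengths to the children increase. -/
theorem ae_exists_shape {k m : ℕ} {θ d : ℝ} (hθ : 0 < θ) (hd : 1 ≤ d) :
    ∀ᵐ t ∂(Measure.pi fun _ : Fin m => pwitLaw d),
      ∃ V : {V : Finset (Fin m × List ℕ) // IsShape k V}, t ∈ treeEvent k θ V.1 := by
  have hreg : ∀ᵐ t ∂(Measure.pi fun _ : Fin m => pwitLaw d),
      ∀ i u, 0 < t i u 0 ∧ StrictMono (t i u) := by
    refine ae_all_iff.2 fun i => ae_all_iff.2 fun u => ?_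
    have h := ae_vertexLaw hd
    rw [← Measure.infinitePi_map_eval (fun _ : List ℕ => vertexLaw d) u, ← pwitLaw_eq] at h
    have h2 := ae_of_ae_map (measurable_pi_apply u).aemeasurable h
    rw [← (measurePreserving_eval (fun _ : Fin m => pwitLaw d) i).map_eq] at h2
    exact ae_of_ae_map (measurable_pi_apply i).aemeasurable h2
  have hfin : ∀ᵐ t ∂(Measure.pi fun _ : Fin m => pwitLaw d),
      {w : Fin m × List ℕ | t ∈ aliveEvent k θ w}.Finite := by
    refine ae_finite_setOfPred_mem ?_
    rw [tsum_aliveEvent]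
    exact ENNReal.mul_ne_top (ENNReal.natCast_ne_top m) (expectedSize_ne_top hθ hd k)
  filter_upwards [hreg, hfin] with t h1 h2
  have hmem : ∀ i u, (i, u) ∈ h2.toFinset ↔ u.length ≤ k ∧ Alive θ (t i) u := by
    intro i u
    rw [Set.Finite.mem_toFinset]
    exact Iff.rfl
  refine ⟨⟨h2.toFinset, ⟨?_, ?_, ?_, ?_⟩⟩, ?_⟩
  · exact fun i => (hmem _ _).2 ⟨Nat.zero_le _, trivial⟩
  · intro i a u h
    obtain ⟨ha, hb⟩ := (hmem _ _).1 h
    exact (hmem _ _).2 ⟨(Nat.le_succ _).trans ha, hb.2⟩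
  · exact fun h => ((hmem _ _).1 h).1
  · intro i a b u hba h
    obtain ⟨ha, hb⟩ := (hmem _ _).1 h
    exact (hmem _ _).2 ⟨ha, ((h1 i u).2.monotone hba).trans hb.1, hb.2⟩
  · intro i u hu hlt
    refine ⟨h1 i u, fun a => ?_⟩
    rw [hmem]
    exact ⟨fun h => ⟨hlt, h, ((hmem _ _).1 hu).2⟩, fun h => h.2.1⟩

theorem pairwise_disjoint_treeEvent (k m : ℕ) (θ : ℝ) :
    Pairwise (Function.onFun Disjoint
      fun V : {V : Finset (Fin m × List ℕ) // IsShape k V} => treeEvent k θ V.1) :=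
  fun V V' hne => Set.disjoint_left.2 fun _ ht ht' =>
    hne (Subtype.ext (treeEvent_disjoint V.2 V'.2 ht ht'))

theorem tsum_treeEvent {k m : ℕ} {θ d : ℝ} (hθ : 0 < θ) (hd : 1 ≤ d) :
    ∑' V : {V : Finset (Fin m × List ℕ) // IsShape k V},
      (Measure.pi fun _ : Fin m => pwitLaw d) (treeEvent k θ V.1) = 1 := by
  rw [← measure_iUnion (pairwise_disjoint_treeEvent k m θ)
    fun V => measurableSet_treeEvent k θ V.1]
  have h : (⋃ V : {V : Finset (Fin m × List ℕ) // IsShape k V}, treeEvent k θ V.1) =ᵐ[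
      Measure.pi fun _ : Fin m => pwitLaw d] Set.univ := by
    filter_upwards [ae_exists_shape hθ hd] with t ht
    exact propext (iff_of_true (Set.mem_iUnion.2 ht) trivial)
  rw [measure_congr h, measure_univ]

/-- This bounds the expected size of the shape. After exchanging sums, the events of the shapes
containing a given `w` are disjoint and contained in `aliveEvent k θ w`. -/
theorem tsum_card_mul_treeEvent_le (k : ℕ) (θ d : ℝ) (m : ℕ) :
    ∑' V : {V : Finset (Fin m × List ℕ) // IsShape k V}, (V.1.card : ℝ≥0∞) *
      (Measure.pi fun _ : Fin m => pwitLaw d) (treeEvent k θ V.1) ≤ m * expectedSize θ d k := by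
  classical
  set μ := Measure.pi fun _ : Fin m => pwitLaw d
  have hcard : ∀ V : {V : Finset (Fin m × List ℕ) // IsShape k V},
      (V.1.card : ℝ≥0∞) * μ (treeEvent k θ V.1) =
        ∑' w : Fin m × List ℕ, μ (if w ∈ V.1 then treeEvent k θ V.1 else ∅) := by
    intro V
    rw [tsum_eq_sum (s := V.1) fun w hw => by rw [if_neg hw, measure_empty],
      Finset.sum_congr rfl fun w hw => by rw [if_pos hw], Finset.sum_const, nsmul_eq_mul]
  simp only [hcard]
  rw [ENNReal.tsum_comm, ← tsum_aliveEvent]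
  refine ENNReal.tsum_le_tsum fun w => ?_
  rw [← measure_iUnion]
  · refine measure_mono (Set.iUnion_subset fun V => ?_)
    split_ifs with hw
    · exact treeEvent_subset_aliveEvent V.2 hw
    · exact Set.empty_subset _
  · intro V V' hne
    have h := pairwise_disjoint_treeEvent k m θ hne
    simp only [Function.onFun] at h ⊢
    split_ifs <;> simp [h]
  · intro V
    split_ifs
    · exact measurableSet_treeEvent k θ V.1
    · exact .empty

/-! ### The number of labellings -/

/-- This ensures that the weights `n⁻¹ ^ (nonroots V).card`, summed over the labellings of one
shape, do not exceed `1`. -/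
theorem card_labelling_le {n m : ℕ} {v : Fin m → Fin n} {V : Finset (Fin m × List ℕ)} :
    Nat.card (Labelling v V) ≤ n ^ (nonroots V).card := by
  have hc : Nat.card ({w // w ∈ nonroots V} → Fin n) = n ^ (nonroots V).card := by
    rw [Nat.card_eq_fintype_card, Fintype.card_fun, Fintype.card_fin, Fintype.card_coe]
  rw [← hc]
  refine Nat.card_le_card_of_injective (fun (lab : Labelling v V) w => lab.1 (toVertex w)) ?_
  intro lab lab' h
  refine Subtype.ext (funext ?_)
  rintro ⟨⟨i, u⟩, hu⟩
  cases u with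
  | nil => rw [lab.2.2, lab'.2.2]
  | cons a u => exact congrFun h ⟨_, cons_mem_nonroots.2 hu⟩

theorem card_nonroots_add_le {k m : ℕ} {V : Finset (Fin m × List ℕ)} (hV : IsShape k V) :
    (nonroots V).card + m ≤ V.card := by
  classical
  have hinj : Function.Injective fun i : Fin m => ((i, []) : Fin m × List ℕ) :=
    fun i j h => congrArg Prod.fst h
  have h1 : (Finset.univ.image fun i : Fin m => ((i, []) : Fin m × List ℕ)).card = m := by
    rw [Finset.card_image_of_injective _ hinj, Finset.card_univ, Fintype.card_fin]
  refine (congrArg ((nonroots V).card + ·) h1).ge.trans ?_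
  rw [← Finset.card_union_of_disjoint]
  · refine Finset.card_le_card (Finset.union_subset (Finset.filter_subset _ _) ?_)
    intro w hw
    obtain ⟨i, -, rfl⟩ := Finset.mem_image.1 hw
    exact hV.root_mem i
  · rw [Finset.disjoint_left]
    intro w hw hw'
    obtain ⟨i, -, rfl⟩ := Finset.mem_image.1 hw'
    exact (Finset.mem_filter.1 hw).2 rfl

/-- The claim is trivial if `N ≥ n^(1/3)`. Otherwise every factor of the descending factorial is at
least `n - N`, and by Bernoulli's inequality the loss is at most `j * N / n`, which is at most `N /
n^(1/3)` because `j ≤ n^(1/3)`. -/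
theorem one_le_descFactorial_div_add {n m j N : ℕ} (hn : 0 < n) (hN : j + m ≤ N) :
    1 ≤ ((n - m).descFactorial j : ℝ) / (n : ℝ) ^ j + N / (n : ℝ) ^ (1 / 3 : ℝ) := by
  have hn1 : (1 : ℝ) ≤ n := by exact_mod_cast hn
  set x := (n : ℝ) ^ (1 / 3 : ℝ) with hx
  have hx1 : 1 ≤ x := Real.one_le_rpow hn1 (by norm_num)
  have hx3 : x ^ 3 = n := by
    rw [hx, ← Real.rpow_natCast, ← Real.rpow_mul (by linarith)]
    norm_num
  rcases le_or_gt x N with h | h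
  · have h1 : 1 ≤ (N : ℝ) / x := (one_le_div (by linarith)).2 h
    have h2 : 0 ≤ ((n - m).descFactorial j : ℝ) / (n : ℝ) ^ j := by positivity
    linarith
  have hN0 : (0 : ℝ) ≤ N := by positivity
  have hNn : (N : ℝ) < n := by
    rw [← hx3]
    nlinarith [sq_nonneg x, mul_nonneg (sub_nonneg.2 hx1) (sub_nonneg.2 hx1)]
  have hNn' : N < n := by exact_mod_cast hNn
  have hdesc : ((n : ℝ) - N) ^ j ≤ ((n - m).descFactorial j : ℝ) := by
    have h1 : (n - N) ^ j ≤ (n - m).descFactorial j :=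
      (Nat.pow_le_pow_left (by omega) j).trans (Nat.pow_sub_le_descFactorial (n - m) j)
    have h2 : (((n - N : ℕ) : ℝ)) ^ j ≤ ((n - m).descFactorial j : ℝ) := by exact_mod_cast h1
    rwa [Nat.cast_sub hNn'.le] at h2
  have hn0 : (0 : ℝ) < n := by linarith
  have h1 : 1 - (j : ℝ) * (N / n) ≤ ((n - m).descFactorial j : ℝ) / (n : ℝ) ^ j := by
    rw [le_div_iff₀ (by positivity)]
    refine le_trans ?_ hdesc
    have hb := one_add_mul_le_pow (a := -((N : ℝ) / n)) (by
      have : (N : ℝ) / n ≤ 1 := (div_le_one hn0).2 hNn.le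
      linarith) j
    calc _ = (1 + (j : ℝ) * -((N : ℝ) / n)) * (n : ℝ) ^ j := by ring
      _ ≤ (1 + -((N : ℝ) / n)) ^ j * (n : ℝ) ^ j := by gcongr
      _ = ((n : ℝ) - N) ^ j := by
          rw [← mul_pow]
          congr 1
          field_simp
          ring
  have h2 : (j : ℝ) * (N / n) ≤ N / x := by
    have hj : (j : ℝ) ≤ x := by
      have : (j : ℝ) ≤ N := by exact_mod_cast (by omega : j ≤ N)
      linarith
    rw [← hx3, mul_div_assoc', div_le_div_iff₀ (by positivity) (by linarith)]
    have : (j : ℝ) * N * x ≤ x * N * x := by gcongr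
    nlinarith [mul_nonneg hN0 (mul_nonneg (sq_nonneg x) (sub_nonneg.2 hx1))]
  linarith

theorem one_le_card_labelling_mul_add {k n m : ℕ} (hn : 0 < n) {v : Fin m → Fin n}
    (hv : Function.Injective v) {V : Finset (Fin m × List ℕ)} (hV : IsShape k V) :
    (1 : ℝ≥0∞) ≤ Nat.card (Labelling v V) * (n : ℝ≥0∞)⁻¹ ^ (nonroots V).card +
      V.card * ENNReal.ofReal ((n : ℝ) ^ (1 / 3 : ℝ))⁻¹ := by
  have hn0 : (0 : ℝ) < n := by exact_mod_cast hn
  have h := one_le_descFactorial_div_add (m := m) hn (card_nonroots_add_le hV)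
  have h1 := ENNReal.ofReal_le_ofReal h
  rw [ENNReal.ofReal_one, ENNReal.ofReal_add (by positivity) (by positivity), div_eq_mul_inv,
    div_eq_mul_inv, ENNReal.ofReal_mul (by positivity), ENNReal.ofReal_mul (by positivity),
    ENNReal.ofReal_natCast, ENNReal.ofReal_natCast, ← inv_pow,
    ENNReal.ofReal_pow (by positivity), ENNReal.ofReal_inv_of_pos hn0,
    ENNReal.ofReal_natCast] at h1
  refine h1.trans ?_
  gcongr
  exact le_card_labelling hv V

/-! ### The coupling -/

/-- The set on which the coupling makes the neighborhoods isomorphic. -/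
def goodEvent (k : ℕ) (θ : ℝ) {n m : ℕ} (v : Fin m → Fin n) :
    Set ((Edges n → ℝ) × (Fin m → List ℕ → ℕ → ℝ)) :=
  {p | ∃ x : LabelledShape k v, p.2 ∈ treeEvent k θ x.1.1 ∧ p.1 ∈ graphEvent θ x.1.2 x.2 ∧
    treeLengths x.1.1 p.2 = graphLengths x.1.2 x.2 p.1}

theorem measurableSet_goodEvent (k : ℕ) (θ : ℝ) {n m : ℕ} (v : Fin m → Fin n) :
    MeasurableSet (goodEvent k θ v) := by
  rw [goodEvent, Set.ofPred_exists]
  refine MeasurableSet.iUnion fun x => ?_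
  exact (measurable_snd (measurableSet_treeEvent k θ x.1.1)).inter
    ((measurable_fst (measurableSet_graphEvent θ x.1.2 x.2)).inter
      (measurableSet_eq_fun ((measurable_treeLengths x.1.1).comp measurable_snd)
        ((measurable_graphLengths x.1.2 x.2).comp measurable_fst)))

theorem exists_coupling_goodEvent {k n m : ℕ} (hk : 0 < k) (hn : 0 < n) {θ d : ℝ} (hθ : 0 < θ)
    (hd : 1 ≤ d) {v : Fin m → Fin n} (hv : Function.Injective v) :
    ∃ γ : Measure ((Edges n → ℝ) × (Fin m → List ℕ → ℕ → ℝ)),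
      IsCoupling γ (meanFieldLaw n d) (Measure.pi fun _ : Fin m => pwitLaw d) ∧
      ENNReal.ofReal (1 - (m * θ ^ d + m + 1) ^ k / (n : ℝ) ^ (1 / 3 : ℝ)) ≤
        γ (goodEvent k θ v) := by
  set μ := Measure.pi fun _ : Fin m => pwitLaw d
  have hn0 : (n : ℝ≥0∞) ≠ 0 := by exact_mod_cast hn.ne'
  let c : LabelledShape k v → ℝ≥0∞ := fun x => (n : ℝ≥0∞)⁻¹ ^ (nonroots x.1.1).card
  -- The weight of a labelled shape depends only on its shape, so summing over labellings just
  -- counts them.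
  have hsum : ∀ F : {V : Finset (Fin m × List ℕ) // IsShape k V} → ℝ≥0∞,
      ∑' x : LabelledShape k v, c x * F x.1 = ∑' V : {V : Finset (Fin m × List ℕ) // IsShape k V},
        Nat.card (Labelling v V.1) * (n : ℝ≥0∞)⁻¹ ^ (nonroots V.1).card * F V := by
    intro F
    rw [ENNReal.tsum_sigma']
    refine tsum_congr fun V => ?_
    have := Fintype.ofFinite (Labelling v V.1)
    rw [tsum_fintype, mul_assoc, Nat.card_eq_fintype_card, ← nsmul_eq_mul, ← Finset.card_univ]
    exact Finset.sum_const ((n : ℝ≥0∞)⁻¹ ^ (nonroots V.1).card * F V)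
  obtain ⟨γ, hγ, hmass⟩ := exists_coupling_of_family (ι := LabelledShape k v)
    (meanFieldLaw n d) μ (A := fun x => treeEvent k θ x.1.1) (B := fun x => graphEvent θ x.1.2 x.2)
    (fun x => measurableSet_treeEvent k θ x.1.1) (fun x => measurableSet_graphEvent θ x.1.2 x.2)
    (graphEvent_disjoint k v θ) (c := c) (fun x => by simp [c, hn0])
    (fun x => measurable_treeLengths x.1.1) (fun x => measurable_graphLengths x.1.2 x.2)
    (fun x => map_treeLengths_le hn hθ hd x.1.2 x.2) (by
      refine Measure.le_iff.2 fun s hs => ?_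
      rw [Measure.sum_apply _ hs]
      simp only [Measure.smul_apply, smul_eq_mul]
      rw [hsum fun V => μ.restrict (treeEvent k θ V.1) s]
      calc _ ≤ ∑' V : {V : Finset (Fin m × List ℕ) // IsShape k V},
            μ.restrict (treeEvent k θ V.1) s := by
            refine ENNReal.tsum_le_tsum fun V => mul_le_of_le_one_left' ?_
            rw [← ENNReal.inv_pow, ← div_eq_mul_inv]
            refine ENNReal.div_le_of_le_mul ?_
            rw [one_mul, ← Nat.cast_pow, Nat.cast_le]
            exact card_labelling_le
        _ = μ.restrict (⋃ V : {V : Finset (Fin m × List ℕ) // IsShape k V},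
              treeEvent k θ V.1) s := by
            rw [Measure.restrict_iUnion (pairwise_disjoint_treeEvent k m θ)
              fun V => measurableSet_treeEvent k θ V.1, Measure.sum_apply _ hs]
        _ ≤ μ s := Measure.restrict_apply_le _ _)
  refine ⟨γ, hγ, le_trans ?_ hmass⟩
  rw [hsum fun V => μ (treeEvent k θ V.1)]
  set q := ENNReal.ofReal ((n : ℝ) ^ (1 / 3 : ℝ))⁻¹
  -- The tree events have total mass `1`; averaging the bound for each shape shows that the
  -- unmatched mass is at most `q` times the expected size.
  have hone : 1 ≤ (∑' V : {V : Finset (Fin m × List ℕ) // IsShape k V},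
      Nat.card (Labelling v V.1) * (n : ℝ≥0∞)⁻¹ ^ (nonroots V.1).card * μ (treeEvent k θ V.1)) +
      q * (m * expectedSize θ d k) := by
    calc (1 : ℝ≥0∞) = ∑' V : {V : Finset (Fin m × List ℕ) // IsShape k V},
          1 * μ (treeEvent k θ V.1) := by
          simp only [one_mul]
          exact (tsum_treeEvent hθ hd).symm
      _ ≤ ∑' V : {V : Finset (Fin m × List ℕ) // IsShape k V},
          (Nat.card (Labelling v V.1) * (n : ℝ≥0∞)⁻¹ ^ (nonroots V.1).card *
            μ (treeEvent k θ V.1) + q * (V.1.card * μ (treeEvent k θ V.1))) := by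
          refine ENNReal.tsum_le_tsum fun V => ?_
          refine (mul_le_mul' (one_le_card_labelling_mul_add hn hv V.2) le_rfl).trans
            (le_of_eq ?_)
          ring
      _ ≤ _ := by
          rw [ENNReal.tsum_add, ENNReal.tsum_mul_left]
          gcongr
          exact tsum_card_mul_treeEvent_le k θ d m
  have hexp : q * (m * expectedSize θ d k) ≤
      ENNReal.ofReal ((m * θ ^ d + m + 1) ^ k / (n : ℝ) ^ (1 / 3 : ℝ)) := by
    have hl := (Real.rpow_pos_of_pos hθ d).le
    rw [div_eq_mul_inv, mul_comm, ENNReal.ofReal_mul (by positivity),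
      ENNReal.ofReal_pow (by positivity), ENNReal.ofReal_add (by positivity) (by positivity),
      ENNReal.ofReal_add (by positivity) (by positivity), ENNReal.ofReal_mul (by positivity),
      ENNReal.ofReal_natCast, ENNReal.ofReal_one]
    gcongr
    obtain ⟨k, rfl⟩ := Nat.exists_eq_succ_of_ne_zero hk.ne'
    exact le_self_add.trans (mul_expectedSize_le hθ hd m k)
  rw [ENNReal.ofReal_sub _ (by
    have hl := (Real.rpow_pos_of_pos hθ d).le
    positivity), ENNReal.ofReal_one]
  exact tsub_le_iff_right.2 (hone.trans (by gcongr))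

end MeanField

/-! ### Averaging over the random roots -/

theorem mainTheorem8 (k n m : ℕ) (hk : 0 < k) (hn : 0 < n) (θ d : ℝ) (hθ : 0 < θ) (hd : 1 ≤ d)
    (ν : Measure (Fin m → Fin n)) [IsProbabilityMeasure ν]
    (hν : ∀ᵐ v ∂ν, Function.Injective v) :
    ∃ γ : Measure (((Fin m → Fin n) × (Edges n → ℝ)) × (Fin m → List ℕ → ℕ → ℝ)),
      IsCoupling γ (ν.prod (meanFieldLaw n d)) (Measure.pi fun _ : Fin m => pwitLaw d) ∧
      ∃ S, MeasurableSet S ∧ (∀ ω ∈ S, NbhdsIsomorphic k θ ω.1.1 ω.1.2 ω.2) ∧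
        ENNReal.ofReal (1 - (m * θ ^ d + m + 1) ^ k / (n : ℝ) ^ (1 / 3 : ℝ)) ≤ γ S := by
  obtain ⟨γ, hγ, hb⟩ := exists_coupling_of_conditional ν (meanFieldLaw n d)
    (Measure.pi fun _ : Fin m => pwitLaw d) (measurableSet_goodEvent k θ)
    (hν.mono fun v hv => exists_coupling_goodEvent hk hn hθ hd hv)
  refine ⟨γ, hγ, _, ?_, ?_, hb⟩
  -- The roots take finitely many values, so the good set is a countable union of measurable pieces.
  · have : {ω : ((Fin m → Fin n) × (Edges n → ℝ)) × (Fin m → List ℕ → ℕ → ℝ) |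
        (ω.1.2, ω.2) ∈ goodEvent k θ ω.1.1} =
        ⋃ v, {ω | ω.1.1 = v} ∩ (fun ω => (ω.1.2, ω.2)) ⁻¹' goodEvent k θ v := by
      ext ω
      simp
    rw [this]
    exact MeasurableSet.iUnion fun v =>
      (measurableSet_eq_fun (by fun_prop) measurable_const).inter
        ((by fun_prop : Measurable fun ω : ((Fin m → Fin n) × (Edges n → ℝ)) ×
          (Fin m → List ℕ → ℕ → ℝ) => (ω.1.2, ω.2)) (measurableSet_goodEvent k θ v))
  · rintro ω ⟨x, h1, h2, h3⟩
    exact nbhdsIsomorphic x.1.2 x.2 h1 h2 h3
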